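/- All graphs are finite, simple and undirected; $\Delta(G)$ is the maximum degree of $G$. A walk in $G$ is a non-empty sequence $v_1,\dots,v_n$ of vertices with $v_iv_{i+1}\in E(G)$ for $1\le i<n$; its length is $n$ and its order is the number of distinct vertices in it. It is a path if its vertices are pairwise distinct. A walk $v_1,\dots,v_{2t}$ is repetitively coloured by a vertex colouring $\varphi$ if $\varphi(v_i)=\varphi(v_{t+i})$ for all $i\in\{1,\dots,t\}$, and is boring if $v_i=v_{t+i}$ for all $i\in\{1,\dots,t\}$. A colouring is walk-nonrepetitive if every repetitively coloured walk is boring, path-nonrepetitive if no path is repetitively coloured, and distance-$2$ if any two distinct vertices at distance at most $2$ receive different colours. Let $\sigma(G)$ be the minimum number of colours in a walk-nonrepetitive colouring of $G$, and for an integer $\Delta\ge 0$ let $\sigma(\Delta)$ be the supremum of $\sigma(G)$ over all graphs $G$ with $\Delta(G)\le\Delta$. Conjecture SmallWalks is the following assertion: there is a function $h:\mathbb{N}\to\mathbb{N}$ such that, for every graph $G$ and every path-nonrepetitive distance-$2$ colouring of $G$ with $c$ colours for which $G$ contains a repetitively coloured non-boring walk, $G$ contains a repetitively coloured non-boring walk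 whose length is at most $h(c)\cdot k$, where $k$ is the order of that walk. Theorem. If Conjecture SmallWalks is true, then there is a function $f:\mathbb{N}\to\mathbb{N}$ such that $\sigma(\Delta)\le f(\Delta)$ for every integer $\Delta\ge 0$, and every graph $G$ has a walk-nonrepetitive colouring with $f(\Delta(G))$ colours. -/

import Mathlib

namespace WalkColouring

variable {V : Type*} {C : Type*}

/-- A walk `v_1, …, v_n` is a `SimpleGraph.Walk`; its length is its number of entries `n`,
which is one more than Mathlib's number of edges `p.length`. -/
def walkLength {G : SimpleGraph V} {u v : V} (p : G.Walk u v) : ℕ :=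
  p.support.length

/-- The order of a walk is its number of distinct vertices. -/
noncomputable def walkOrder {G : SimpleGraph V} {u v : V} (p : G.Walk u v) : ℕ :=
  {x : V | x ∈ p.support}.ncard

/-- A walk `v_1, …, v_{2t}` is repetitively coloured by `f` if `f v_i = f v_{t+i}` for all
`1 ≤ i ≤ t`. Here `p.getVert i` is `v_{i+1}`. -/
def IsRepetitive {G : SimpleGraph V} (f : V → C) {u v : V} (p : G.Walk u v) : Prop :=
  ∃ t : ℕ, walkLength p = 2 * t ∧ ∀ i < t, f (p.getVert i) = f (p.getVert (t + i))

/-- A walk `v_1, …, v_{2t}` is boring if `v_i = v_{t+i}` for all `1 ≤ i ≤ t`. -/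
def IsBoring {G : SimpleGraph V} {u v : V} (p : G.Walk u v) : Prop :=
  ∃ t : ℕ, walkLength p = 2 * t ∧ ∀ i < t, p.getVert i = p.getVert (t + i)

/-- The only walks that are repetitively coloured by `f` are boring. -/
def IsWalkNonrepetitive (G : SimpleGraph V) (f : V → C) : Prop :=
  ∀ (u v : V) (p : G.Walk u v), IsRepetitive f p → IsBoring p

/-- No path is repetitively coloured by `f`. -/
def IsPathNonrepetitive (G : SimpleGraph V) (f : V → C) : Prop :=
  ∀ (u v : V) (p : G.Walk u v), p.IsPath → ¬ IsRepetitive f p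

/-- The square of `G`: distinct vertices are adjacent if their distance in `G` is at most 2. -/
def square (G : SimpleGraph V) : SimpleGraph V where
  Adj v w := v ≠ w ∧ G.edist v w ≤ 2
  symm := ⟨fun v w h => ⟨h.1.symm, by rw [SimpleGraph.edist_comm]; exact h.2⟩⟩
  loopless := ⟨fun _ h => h.1 rfl⟩

/-- A distance-2 colouring of `G` is a proper colouring of its square. -/
def IsDistanceTwoColouring (G : SimpleGraph V) (f : V → C) : Prop :=
  ∀ v w : V, (square G).Adj v w → f v ≠ f w

/-- The conjecture on small walks: for some function `h`, whenever a path-nonrepetitive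
distance-2 colouring of a finite graph with `c` colours admits a repetitively coloured non-boring
walk, it admits one of length at most `h c` times its order. -/
def SmallWalksConjecture : Prop :=
  ∃ h : ℕ → ℕ, ∀ (V : Type) [Fintype V] (G : SimpleGraph V) (c : ℕ) (f : V → Fin c),
    IsPathNonrepetitive G f → IsDistanceTwoColouring G f →
    (∃ (u v : V) (p : G.Walk u v), IsRepetitive f p ∧ ¬ IsBoring p) →
    ∃ (u v : V) (p : G.Walk u v), IsRepetitive f p ∧ ¬ IsBoring p ∧
      walkLength p ≤ h c * walkOrder p

/-- `σ(G)`: the minimum number of colours in a walk-nonrepetitive colouring of `G`. -/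
noncomputable def sigma (G : SimpleGraph V) : ℕ :=
  sInf {k : ℕ | ∃ f : V → Fin k, IsWalkNonrepetitive G f}

open Classical in
/-- `σ(Δ)`: the supremum in `ℕ∞` of `σ(G)` over all finite graphs `G` with maximum degree at most
`Δ` (every finite graph is isomorphic to one on some `Fin n`). -/
noncomputable def sigmaDegree (Δ : ℕ) : ℕ∞ :=
  ⨆ (n : ℕ) (G : SimpleGraph (Fin n)) (_ : G.maxDegree ≤ Δ), (sigma G : ℕ∞)

/-- The minimum defining `σ(G)` is attained for every finite graph. -/
theorem exists_sigma_colouring [Finite V] (G : SimpleGraph V) :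
    ∃ f : V → Fin (sigma G), IsWalkNonrepetitive G f := by
  have hne : {k : ℕ | ∃ f : V → Fin k, IsWalkNonrepetitive G f}.Nonempty := by
    refine ⟨Nat.card V, Finite.equivFin V, ?_⟩
    rintro u v p ⟨t, ht, h⟩
    exact ⟨t, ht, fun i hi => (Finite.equivFin V).injective (h i hi)⟩
  exact Nat.sInf_mem hne

end WalkColouring

/-! Counting gives a colouring of $G$ without repetitions of length at most a constant times their
order, but the constant from the conjecture depends on the number of colours, which is circular.
Subdivision breaks the circle: each edge is subdivided $N$ times and an $N$-colouring ψ of $G$ is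
written in unary along the edges. The subdivided graph then uses a number $c'$ of colours
independent of $N$, so $h(c')$ is fixed before $N$ and ψ are chosen.

The counting is Rosenfeld's (`exists_avoiding`). In a repetition whose halves differ at every
position, half of the vertices have colours determined by the rest (`exists_determined`); for length
at most $H$ times the order this beats the number of walks (`exists_no_short_repetition`). It is
used for a square-free word τ, for a base colouring `g`, and for ψ.

A repetition in the subdivided graph with halves different everywhere visits original vertices, for
otherwise τ would contain a square. The original vertices visited form a repetition of $G$ under
both `g` and ψ, with length-to-order ratio bounded independently of $N$
(`exists_repetition_of_subdivision`). For paths this contradicts `g`. For a non-boring walk the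
conjecture supplies a short one, which contradicts ψ. So the subdivided colouring is
walk-nonrepetitive. Finally, colouring $G$ by `g`, ψ and the set of these pairs on the neighbours
makes every non-boring repetition of $G$ lift to the subdivision (`exists_lift`), where there is
none. -/

namespace WalkColouring

/-! ### Counting colourings -/

set_option maxHeartbeats 1000000 in
/-- Rosenfeld's counting argument. Let `bad e` be events about colourings, each depending only on
the vertices in `supp e`. Suppose that for each vertex `v` the events involving `v` are covered by
events `bd i`, in each of which the colours on `D i ∋ v` are determined by the other colours. If
the weights `β ^ (1 - |D i|)` add up to at most `|C| - β`, then some colouring avoids all events. -/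
theorem exists_avoiding {V C E : Type*} [Fintype V] [DecidableEq V] [Fintype C] [Nonempty C]
    (β : ℝ) (hβ : 0 < β) (supp : E → Finset V) (bad : E → Set (V → C))
    (hne : ∀ e, (supp e).Nonempty)
    (hloc : ∀ e f f', (∀ x ∈ supp e, f x = f' x) → f ∈ bad e → f' ∈ bad e)
    (hcov : ∀ v, ∃ (ι : Type) (s : Finset ι) (D : ι → Finset V) (bd : ι → Set (V → C)),
      (∀ e f, v ∈ supp e → f ∈ bad e → ∃ i ∈ s, f ∈ bd i ∧ D i ⊆ supp e) ∧
      (∀ i ∈ s, v ∈ D i ∧ ∀ f f', f ∈ bd i → f' ∈ bd i → (∀ x ∉ D i, f x = f' x) → f = f') ∧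
      ∑ i ∈ s, β / β ^ (D i).card ≤ Fintype.card C - β) :
    ∃ f : V → C, ∀ e, f ∉ bad e := by
  classical
  obtain ⟨c0⟩ := ‹Nonempty C›
  -- Partial colourings of `S` are encoded as total ones with the default `c0` outside `S`.
  let good : Finset V → Finset (V → C) := fun S => Finset.univ.filter
    (fun f => (∀ x, x ∉ S → f x = c0) ∧ ∀ e, supp e ⊆ S → f ∉ bad e)
  have hgood : ∀ S f, f ∈ good S ↔
      (∀ x, x ∉ S → f x = c0) ∧ ∀ e, supp e ⊆ S → f ∉ bad e := by
    intro S f; simp [good]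
  -- Each new vertex multiplies the count by at least `β`. The induction is strong because erasing
  -- `D i` can return to much smaller sets.
  have step : ∀ n : ℕ, ∀ S : Finset V, S.card = n → ∀ v, v ∉ S →
      β * (good S).card ≤ ((good (insert v S)).card : ℝ) := by
    intro n
    induction n using Nat.strong_induction_on with
    | _ n ih =>
    intro S hS v hv
    have chain : ∀ k : ℕ, ∀ T : Finset V, T ⊆ S → (S \ T).card = k →
        β ^ k * (good T).card ≤ ((good S).card : ℝ) := by
      intro k
      induction k with
      | zero =>
        intro T hT hk
        have : T = S := by
          apply Finset.Subset.antisymm hT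
          rwa [Finset.card_eq_zero, Finset.sdiff_eq_empty_iff_subset] at hk
        simp [this]
      | succ k ihk =>
        intro T hT hk
        have hne : (S \ T).Nonempty := by rw [← Finset.card_pos]; omega
        obtain ⟨x, hx⟩ := hne
        rw [Finset.mem_sdiff] at hx
        have h1 : insert x T ⊆ S := Finset.insert_subset hx.1 hT
        have h2 : (S \ insert x T).card = k := by
          have e1 := Finset.card_sdiff_add_card_eq_card hT
          have e2 := Finset.card_sdiff_add_card_eq_card h1
          have e3 := Finset.card_insert_of_notMem hx.2
          omega
        have h3 := ihk _ h1 h2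
        have hlt : T.card < n := by
          have e1 := Finset.card_sdiff_add_card_eq_card hT
          omega
        have h4 := ih _ hlt T rfl x hx.2
        calc β ^ (k + 1) * ((good T).card : ℝ) = β ^ k * (β * (good T).card) := by ring
          _ ≤ β ^ k * ((good (insert x T)).card : ℝ) :=
            mul_le_mul_of_nonneg_left h4 (by positivity)
          _ ≤ _ := h3
    obtain ⟨ι, s, D, bd, hc, hD, hsum⟩ := hcov v
    let F : Finset (V → C) :=
      (good S ×ˢ (Finset.univ : Finset C)).image (fun q => Function.update q.1 v q.2)
    have hFcard : F.card = (good S).card * Fintype.card C := by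
      rw [Finset.card_image_of_injOn, Finset.card_product, Finset.card_univ]
      rintro ⟨f, a⟩ hf ⟨f', a'⟩ hf' heq
      simp only [Finset.coe_product, Set.mem_prod, Finset.mem_coe] at hf hf'
      have ha : a = a' := by simpa using congrFun heq v
      refine Prod.ext ?_ ha
      funext x
      by_cases hxv : x = v
      · subst hxv
        change f x = f' x
        rw [((hgood _ _).1 hf.1).1 x hv, ((hgood _ _).1 hf'.1).1 x hv]
      · simpa [hxv] using congrFun heq x
    have hF0 : ∀ f ∈ F, (∀ x, x ∉ insert v S → f x = c0) ∧ ∀ e, supp e ⊆ S → f ∉ bad e := by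
      intro f hf
      simp only [F, Finset.mem_image, Finset.mem_product] at hf
      obtain ⟨⟨g, a⟩, ⟨hg, -⟩, rfl⟩ := hf
      rw [hgood] at hg
      refine ⟨fun x hx => ?_, fun e he hb => ?_⟩
      · rw [Finset.mem_insert, not_or] at hx
        simpa [hx.1] using hg.1 x hx.2
      · refine hg.2 e he (hloc e _ _ ?_ hb)
        intro x hx
        have : x ≠ v := fun h => hv (h ▸ he hx)
        simp [this]
    let bdF : ι → Finset (V → C) :=
      fun i => F.filter (fun f => f ∈ bd i ∧ D i ⊆ insert v S)
    have hcover : F ⊆ good (insert v S) ∪ s.biUnion bdF := by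
      intro f hf
      by_cases hg : f ∈ good (insert v S)
      · exact Finset.mem_union_left _ hg
      · apply Finset.mem_union_right
        rw [hgood] at hg
        push Not at hg
        obtain ⟨e, he, hb⟩ := hg (hF0 f hf).1
        have hve : v ∈ supp e := by
          by_contra hve
          refine (hF0 f hf).2 e (fun x hx => ?_) hb
          have := he hx
          rw [Finset.mem_insert] at this
          rcases this with rfl | h
          · exact absurd hx hve
          · exact h
        obtain ⟨i, his, hfi, hDi⟩ := hc e f hve hb
        rw [Finset.mem_biUnion]
        exact ⟨i, his, by simp only [bdF, Finset.mem_filter]; exact ⟨hf, hfi, hDi.trans he⟩⟩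
    have hbd : ∀ i ∈ s, ((bdF i).card : ℝ) ≤ (good S).card * (β / β ^ (D i).card) := by
      intro i hi
      by_cases hDi : D i ⊆ insert v S
      · obtain ⟨hvD, hdet⟩ := hD i hi
        have hTS : insert v S \ D i ⊆ S := by
          intro x hx
          rw [Finset.mem_sdiff, Finset.mem_insert] at hx
          rcases hx with ⟨rfl | h, h2⟩
          · exact absurd hvD h2
          · exact h
        -- Erasing the colours on `D i` loses no information, by `hdet`, and leaves a good colouring
        -- of a subset of `S`.
        have hle : (bdF i).card ≤ (good (insert v S \ D i)).card := by
          refine Finset.card_le_card_of_injOn (fun f x => if x ∈ D i then c0 else f x) ?_ ?_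
          · intro f hf
            simp only [bdF, Finset.coe_filter, Set.mem_ofPred_eq] at hf
            have hf0 := hF0 f hf.1
            simp only [Finset.mem_coe, hgood]
            refine ⟨fun x hx => ?_, fun e he hb => hf0.2 e (he.trans hTS) (hloc e _ _ ?_ hb)⟩
            · by_cases hxD : x ∈ D i
              · simp [hxD]
              · simp only [hxD, if_false]
                apply hf0.1
                intro h
                exact hx (Finset.mem_sdiff.2 ⟨h, hxD⟩)
            · intro x hx
              have := (Finset.mem_sdiff.1 (he hx)).2
              simp [this]
          · intro f hf f' hf' heq
            simp only [bdF, Finset.coe_filter, Set.mem_ofPred_eq] at hf hf'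
            refine hdet f f' hf.2.1 hf'.2.1 (fun x hx => ?_)
            simpa [hx] using congrFun heq x
        have hcard : (S \ (insert v S \ D i)).card + 1 = (D i).card := by
          have : D i = insert v (S \ (insert v S \ D i)) := by
            ext x
            by_cases hxv : x = v
            · subst hxv; simp [hvD]
            · have := @hDi x
              simp only [Finset.mem_insert, Finset.mem_sdiff, hxv, false_or] at this ⊢
              tauto
          conv_rhs => rw [this]
          rw [Finset.card_insert_of_notMem]
          simp [hv]
        have h5 := chain _ _ hTS rfl
        rw [← hcard, pow_succ]
        have hpos : 0 < β ^ (S \ (insert v S \ D i)).card := by positivity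
        have : β / (β ^ (S \ (insert v S \ D i)).card * β)
            = (β ^ (S \ (insert v S \ D i)).card)⁻¹ := by
          field_simp
        rw [this, ← div_eq_mul_inv, le_div_iff₀ hpos, mul_comm]
        refine le_trans ?_ h5
        exact mul_le_mul_of_nonneg_left (by exact_mod_cast hle) hpos.le
      · have : bdF i = ∅ :=
          Finset.filter_eq_empty_iff.2 fun f _ h => hDi h.2
        rw [this]
        simp only [Finset.card_empty, Nat.cast_zero]
        positivity
    have h6 : (F.card : ℝ) ≤ (good (insert v S)).card + ∑ i ∈ s, ((bdF i).card : ℝ) := by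
      have h7 : F.card ≤ (good (insert v S)).card + ∑ i ∈ s, (bdF i).card :=
        (Finset.card_le_card hcover).trans ((Finset.card_union_le _ _).trans
          (Nat.add_le_add_left Finset.card_biUnion_le _))
      exact_mod_cast h7
    have h8 := Finset.sum_le_sum hbd
    rw [← Finset.mul_sum] at h8
    have h9 : ((good S).card : ℝ) * ∑ i ∈ s, β / β ^ (D i).card
        ≤ (good S).card * (Fintype.card C - β) :=
      mul_le_mul_of_nonneg_left hsum (by positivity)
    rw [hFcard] at h6
    push_cast at h6
    linarith
  have hpos : ∀ S : Finset V, 0 < (good S).card := by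
    intro S
    induction S using Finset.induction_on with
    | empty =>
      rw [Finset.card_pos]
      refine ⟨fun _ => c0, ?_⟩
      rw [hgood]
      refine ⟨fun _ _ => rfl, fun e he => ?_⟩
      exact absurd (Finset.subset_empty.1 he) (hne e).ne_empty
    | insert v S hv ih =>
      have h := step _ S rfl v hv
      have : (0 : ℝ) < β * (good S).card := by positivity
      exact_mod_cast this.trans_le h
  obtain ⟨f, hf⟩ := Finset.card_pos.1 (hpos Finset.univ)
  exact ⟨f, fun e => ((hgood _ _).1 hf).2 e (Finset.subset_univ _)⟩

/-- If a sequence `w 0, …, w (2t-1)` has `w i ≠ w (t+i)` for all `i < t`, then at least half of its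
entries, including a prescribed one, have colours determined by the other colours in every
colouring for which the sequence is a repetition. -/
theorem exists_determined {V : Type*} [DecidableEq V] (t : ℕ) (w : ℕ → V)
    (hw : ∀ i < t, w i ≠ w (t + i)) (v : V) (hv : ∃ i < 2 * t, w i = v) :
    ∃ D : Finset V, v ∈ D ∧ D ⊆ (Finset.range (2 * t)).image w ∧
      ((Finset.range (2 * t)).image w).card ≤ 2 * D.card ∧
      ∀ (C : Type) (f f' : V → C), (∀ i < t, f (w i) = f (w (t + i))) →
        (∀ i < t, f' (w i) = f' (w (t + i))) → (∀ x ∉ D, f x = f' x) → f = f' := by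
  classical
  -- A repetition imposes equality of colours along the classes of `R`; each class met by the
  -- sequence has at least two members.
  let R : V → V → Prop := fun x y => ∃ i < t, x = w i ∧ y = w (t + i)
  let st : Setoid V := Relation.EqvGen.setoid R
  have hpartner : ∀ x ∈ (Finset.range (2 * t)).image w,
      ∃ y ∈ (Finset.range (2 * t)).image w, y ≠ x ∧ st x y := by
    intro x hx
    simp only [Finset.mem_image, Finset.mem_range] at hx ⊢
    obtain ⟨i, hi, rfl⟩ := hx
    by_cases hit : i < t
    · exact ⟨w (t + i), ⟨t + i, by omega, rfl⟩, (hw i hit).symm, .rel _ _ ⟨i, hit, rfl, rfl⟩⟩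
    · obtain ⟨j, rfl⟩ : ∃ j, i = t + j := ⟨i - t, by omega⟩
      exact ⟨w j, ⟨j, by omega, rfl⟩, hw j (by omega),
        .symm _ _ (.rel _ _ ⟨j, by omega, rfl, rfl⟩)⟩
  have hconst : ∀ (C : Type) (f : V → C), (∀ i < t, f (w i) = f (w (t + i))) →
      ∀ x y, st x y → f x = f y := by
    intro C f hf x y hxy
    induction hxy with
    | rel x y h => obtain ⟨i, hi, rfl, rfl⟩ := h; exact hf i hi
    | refl => rfl
    | symm _ _ _ ih => exact ih.symm
    | trans _ _ _ _ _ ih1 ih2 => exact ih1.trans ih2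
  have hvX : v ∈ (Finset.range (2 * t)).image w := by
    simpa using hv
  obtain ⟨v', -, hv'ne, hv'⟩ := hpartner v hvX
  -- One representative per class; in the class of `v` it is a partner of `v`, which puts `v` among
  -- the determined vertices.
  let rep : V → V := fun x => if st x v then v' else (Quotient.mk st x).out
  have hrep : ∀ x, st x (rep x) := by
    intro x
    by_cases h : st x v
    · simp only [rep, h, if_true]; exact st.trans h hv'
    · simp only [rep, h, if_false]
      exact st.symm (Quotient.mk_out x)
  have hreq : ∀ x y, st x y → rep x = rep y := by
    intro x y h
    have e : Quotient.mk st x = Quotient.mk st y := Quotient.sound h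
    by_cases h1 : st x v
    · have h2 : st y v := st.trans (st.symm h) h1
      simp [rep, h1, h2]
    · have h2 : ¬ st y v := fun h2 => h1 (st.trans h h2)
      simp [rep, h1, h2, e]
  have hrr : ∀ x, rep (rep x) = rep x := fun x => (hreq _ _ (hrep x)).symm
  refine ⟨((Finset.range (2 * t)).image w).filter (fun x => rep x ≠ x), ?_,
    Finset.filter_subset _ _, ?_, ?_⟩
  · rw [Finset.mem_filter]
    refine ⟨hvX, ?_⟩
    have : rep v = v' := by simp only [rep, if_pos (st.refl v)]
    rwa [this]
  · have h1 := Finset.card_filter_add_card_filter_not (s := (Finset.range (2 * t)).image w)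
      (fun x => rep x ≠ x)
    choose! p hpX hpne hpst using hpartner
    have h2 : (((Finset.range (2 * t)).image w).filter (fun x => ¬ rep x ≠ x)).card ≤
        (((Finset.range (2 * t)).image w).filter (fun x => rep x ≠ x)).card := by
      refine Finset.card_le_card_of_injOn p ?_ ?_
      · intro x hx
        simp only [Finset.coe_filter, Set.mem_ofPred_eq, not_not] at hx ⊢
        refine ⟨hpX x hx.1, ?_⟩
        rw [← hreq _ _ (hpst x hx.1), hx.2]
        exact (hpne x hx.1).symm
      · intro x hx y hy hxy
        simp only [Finset.coe_filter, Set.mem_ofPred_eq, not_not] at hx hy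
        rw [← hx.2, ← hy.2, hreq _ _ (hpst x hx.1), hreq _ _ (hpst y hy.1), hxy]
    omega
  · intro C f f' hf hf' hD
    funext x
    have : ∀ y, rep y = y → f y = f' y := by
      intro y hy
      apply hD
      simp [hy]
    rw [hconst C f hf x _ (hrep x), hconst C f' hf' x _ (hrep x), this _ (hrr x)]

/-! ### Colourings without short repetitions -/

/-- The sequence that starts at `v` and moves at step `n` to the neighbour with index `κ n`. -/
def followFrom {V : Type*} {D : ℕ} (nb : V → Fin D → V) (v : V) : (ℕ → Fin D) → ℕ → V
  | _, 0 => v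
  | κ, n + 1 => nb (followFrom nb v κ n) (κ n)

theorem followFrom_congr {V : Type*} {D : ℕ} (nb : V → Fin D → V) (v : V) (κ κ' : ℕ → Fin D)
    (n : ℕ) (h : ∀ i < n, κ i = κ' i) : followFrom nb v κ n = followFrom nb v κ' n := by
  induction n with
  | zero => rfl
  | succ n ih =>
    simp only [followFrom]
    rw [ih fun i hi => h i (by omega), h n (by omega)]

/-- Recording the index of each step codes a walk from a given vertex, so at most `D ^ n` walks with
`n` steps have to be counted. -/
theorem exists_followFrom {V : Type*} {D : ℕ} [NeZero D] (nb : V → Fin D → V) (w : ℕ → V) (n : ℕ)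
    (h : ∀ i < n, ∃ k, nb (w i) k = w (i + 1)) :
    ∃ κ : ℕ → Fin D, ∀ i ≤ n, followFrom nb (w 0) κ i = w i := by
  choose! κ hκ using h
  refine ⟨κ, fun i hi => ?_⟩
  induction i with
  | zero => rfl
  | succ i ih =>
    simp only [followFrom]
    rw [ih (by omega), hκ i (by omega)]

/-- The ratio is `2t / 8 ^ t`, and `2t ≤ 4 ^ t` leaves a geometric series. This is the total weight
of the events at a vertex, relative to `β`. -/
theorem sum_weights_le (D T : ℕ) (hD : 0 < D) :
    ∑ t ∈ Finset.Icc 1 T, ((2 * t : ℝ) * (D : ℝ) ^ (4 * t)) / (8 * (D : ℝ) ^ 4) ^ t ≤ 1 := by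
  have h1 : ∀ t ∈ Finset.Icc 1 T,
      ((2 * t : ℝ) * (D : ℝ) ^ (4 * t)) / (8 * (D : ℝ) ^ 4) ^ t ≤ (1 / 2 : ℝ) ^ t := by
    intro t ht
    have hD' : (0 : ℝ) < D := by exact_mod_cast hD
    rw [mul_pow, ← pow_mul, mul_div_mul_right _ _ (by positivity)]
    have h2 : (2 * t : ℝ) ≤ 4 ^ t := by
      have : 2 * t ≤ 4 ^ t := by
        rw [Finset.mem_Icc] at ht
        obtain ⟨h1, -⟩ := ht
        induction t, h1 using Nat.le_induction with
        | base => norm_num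
        | succ t h ih => rw [pow_succ]; omega
      exact_mod_cast this
    rw [div_le_iff₀ (by positivity), ← mul_pow]
    norm_num
    exact h2
  refine (Finset.sum_le_sum h1).trans ?_
  have h3 : ∀ T : ℕ, ∑ t ∈ Finset.Icc 1 T, (1 / 2 : ℝ) ^ t = 1 - (1 / 2) ^ T := by
    intro T
    induction T with
    | zero => simp
    | succ T ih =>
      rw [Finset.sum_Icc_succ_top (by omega), ih, pow_succ]
      ring
  rw [h3]
  have : (0 : ℝ) < (1 / 2) ^ T := by positivity
  linarith

/-- For a relation of bounded degree there is a colouring, with a bounded number of colours,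
without repetitions `w 0, …, w (2t-1)` such that `w i ≠ w (t+i)` and whose length is at most `H`
times the order. -/
theorem exists_no_short_repetition (D H : ℕ) (hD : 0 < D) :
    ∃ N : ℕ, 0 < N ∧ ∀ (V : Type) [Fintype V] [DecidableEq V] (r : V → V → Prop)
      (nb : V → Fin D → V), (∀ v w, r v w → ∃ k, nb v k = w) → (∀ v w, r v w → r w v) →
      ∃ f : V → Fin N, ∀ (t : ℕ) (w : ℕ → V), 1 ≤ t → (∀ i, i + 1 < 2 * t → r (w i) (w (i + 1))) →
        (∀ i < t, w i ≠ w (t + i)) → 2 * t ≤ H * ((Finset.range (2 * t)).image w).card →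
        ¬ ∀ i < t, f (w i) = f (w (t + i)) := by
  classical
  set B : ℝ := 8 * (D : ℝ) ^ 4 with hB
  have hD' : (1 : ℝ) ≤ D := by exact_mod_cast hD
  have hB1 : 1 ≤ B := by
    have := one_le_pow₀ hD' (n := 4)
    linarith
  -- Twice `β = B ^ H`, so that the weights at a vertex may add up to `β`.
  refine ⟨2 * (8 * D ^ 4) ^ H, by positivity, ?_⟩
  intro V _ _ r nb hnb hsymm
  have : NeZero D := ⟨hD.ne'⟩
  have : NeZero (2 * (8 * D ^ 4) ^ H) := ⟨by positivity⟩
  let E := {e : ℕ × (ℕ → V) // 1 ≤ e.1 ∧ (∀ i, i + 1 < 2 * e.1 → r (e.2 i) (e.2 (i + 1))) ∧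
    (∀ i < e.1, e.2 i ≠ e.2 (e.1 + i)) ∧
    2 * e.1 ≤ H * ((Finset.range (2 * e.1)).image e.2).card}
  let supp : E → Finset V := fun e => (Finset.range (2 * e.1.1)).image e.1.2
  let bad : E → Set (V → Fin (2 * (8 * D ^ 4) ^ H)) :=
    fun e => {f | ∀ i < e.1.1, f (e.1.2 i) = f (e.1.2 (e.1.1 + i))}
  have key := exists_avoiding (B ^ H) (by positivity) supp bad ?_ ?_ ?_
  · obtain ⟨f, hf⟩ := key
    exact ⟨f, fun t w ht h1 h2 h3 h4 => hf ⟨(t, w), ht, h1, h2, h3⟩ h4⟩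
  · rintro ⟨⟨t, w⟩, ht, -⟩
    refine ⟨w 0, ?_⟩
    simp only [supp, Finset.mem_image, Finset.mem_range]
    exact ⟨0, by change 1 ≤ t at ht; omega, rfl⟩
  · rintro ⟨⟨t, w⟩, ht, hrest⟩ f f' h hf
    intro i hi
    change i < t at hi
    have m1 : ∀ j < 2 * t, f (w j) = f' (w j) := by
      intro j hj
      apply h
      simp only [supp, Finset.mem_image, Finset.mem_range]
      exact ⟨j, hj, rfl⟩
    have := hf i hi
    change f (w i) = f (w (t + i)) at this
    change f' (w i) = f' (w (t + i))
    rw [← m1 i (by omega), ← m1 (t + i) (by omega), this]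
  · intro v
    let κx : ∀ {n : ℕ}, (Fin n → Fin D) → ℕ → Fin D :=
      fun {n} κ i => if h : i < n then κ ⟨i, h⟩ else 0
    -- A sequence through `v` is coded by `t`, the position of `v`, and the indices followed
    -- forwards and backwards from there. Both index lists are padded to length `2 * t`, whence `D ^
    -- (4 * t)`.
    let ι := Σ t : ℕ, Fin (2 * t) × (Fin (2 * t) → Fin D) × (Fin (2 * t) → Fin D)
    let W : ι → ℕ → V := fun i j =>
      if (i.2.1 : ℕ) ≤ j then followFrom nb v (κx i.2.2.1) (j - i.2.1)
      else followFrom nb v (κx i.2.2.2) (i.2.1 - j)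
    let good : ι → Prop := fun i => (∀ j < i.1, W i j ≠ W i (i.1 + j)) ∧
      2 * i.1 ≤ H * ((Finset.range (2 * i.1)).image (W i)).card
    have hWv : ∀ i : ι, ∃ j < 2 * i.1, W i j = v := by
      intro i
      refine ⟨i.2.1, i.2.1.2, ?_⟩
      simp [W, followFrom]
    have hex : ∀ i : ι, good i → ∃ Di : Finset V, v ∈ Di ∧
        Di ⊆ (Finset.range (2 * i.1)).image (W i) ∧
        ((Finset.range (2 * i.1)).image (W i)).card ≤ 2 * Di.card ∧
        ∀ (C : Type) (f f' : V → C), (∀ j < i.1, f (W i j) = f (W i (i.1 + j))) →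
        (∀ j < i.1, f' (W i j) = f' (W i (i.1 + j))) → (∀ x ∉ Di, f x = f' x) → f = f' :=
      fun i hi => exists_determined i.1 (W i) hi.1 v (hWv i)
    choose! Ds hDs1 hDs2 hDs3 hDs4 using hex
    refine ⟨ι, ((Finset.Icc 1 (H * Fintype.card V)).sigma fun _ => Finset.univ).filter good, Ds,
      fun i => {f | ∀ j < i.1, f (W i j) = f (W i (i.1 + j))}, ?_, ?_, ?_⟩
    · rintro ⟨⟨t, w⟩, ht, h1, h2, h3⟩ f hv hf
      change 1 ≤ t at ht
      change ∀ i, i + 1 < 2 * t → r (w i) (w (i + 1)) at h1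
      change ∀ i < t, w i ≠ w (t + i) at h2
      change 2 * t ≤ H * ((Finset.range (2 * t)).image w).card at h3
      change ∀ i < t, f (w i) = f (w (t + i)) at hf
      change v ∈ (Finset.range (2 * t)).image w at hv
      simp only [Finset.mem_image, Finset.mem_range] at hv
      obtain ⟨p, hp, rfl⟩ := hv
      obtain ⟨κ₁, hκ₁⟩ := exists_followFrom nb (fun i => w (p + i)) (2 * t - 1 - p)
        (fun i hi => hnb _ _ (h1 _ (by omega)))
      obtain ⟨κ₂, hκ₂⟩ := exists_followFrom nb (fun i => w (p - i)) p
        (fun i hi => hnb _ _ (hsymm _ _ (by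
          have := h1 (p - (i + 1)) (by omega)
          rwa [show p - (i + 1) + 1 = p - i by omega] at this)))
      let i : ι := ⟨t, ⟨p, hp⟩, fun j => κ₁ j, fun j => κ₂ j⟩
      have hW : ∀ j < 2 * t, W i j = w j := by
        intro j hj
        by_cases hpj : p ≤ j
        · simp only [W, i, hpj, if_true]
          rw [followFrom_congr nb _ _ κ₁, ← show p + (j - p) = j by omega]
          · simpa using hκ₁ (j - p) (by omega)
          · intro k hk
            have : k < 2 * t := by omega
            simp [κx, this]
        · simp only [W, i, hpj, if_false]
          rw [followFrom_congr nb _ _ κ₂]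
          · have := hκ₂ (p - j) (by omega)
            simpa [show p - (p - j) = j by omega] using this
          · intro k hk
            have : k < 2 * t := by omega
            simp [κx, this]
      have himg : (Finset.range (2 * t)).image (W i) = (Finset.range (2 * t)).image w :=
        Finset.image_congr fun j hj => hW j (by simpa using hj)
      have hgi : good i := by
        refine ⟨fun j hj => ?_, ?_⟩
        · change j < t at hj
          change W i j ≠ W i (t + j)
          rw [hW j (by omega), hW (t + j) (by omega)]
          exact h2 j hj
        · change 2 * t ≤ H * ((Finset.range (2 * t)).image (W i)).card
          rw [himg]; exact h3
      refine ⟨i, ?_, ?_, ?_⟩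
      · rw [Finset.mem_filter, Finset.mem_sigma, Finset.mem_Icc]
        refine ⟨⟨⟨ht, ?_⟩, Finset.mem_univ _⟩, hgi⟩
        change t ≤ _
        have := Nat.mul_le_mul_left H (Finset.card_le_univ ((Finset.range (2 * t)).image w))
        omega
      · intro j hj
        change j < t at hj
        change f (W i j) = f (W i (t + j))
        rw [hW j (by omega), hW (t + j) (by omega)]
        exact hf j hj
      · have := hDs2 i hgi
        change Ds i ⊆ (Finset.range (2 * t)).image (W i) at this
        rw [himg] at this
        exact this
    · intro i hi
      rw [Finset.mem_filter] at hi
      exact ⟨hDs1 i hi.2, hDs4 i hi.2 _⟩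
    · have hb : ∀ i ∈ ((Finset.Icc 1 (H * Fintype.card V)).sigma fun _ => Finset.univ).filter good,
          B ^ H / (B ^ H) ^ (Ds i).card ≤ B ^ H / B ^ i.1 := by
        intro i hi
        rw [Finset.mem_filter] at hi
        rw [← pow_mul]
        refine div_le_div_of_nonneg_left (by positivity) (by positivity) ?_
        refine pow_le_pow_right₀ hB1 ?_
        have e1 := hi.2.2
        have e2 := Nat.mul_le_mul_left H (hDs3 i hi.2)
        have e3 : H * (2 * (Ds i).card) = 2 * (H * (Ds i).card) := by ring
        omega
      refine (Finset.sum_le_sum hb).trans ?_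
      refine (Finset.sum_le_sum_of_subset_of_nonneg (Finset.filter_subset _ _)
        (fun i _ _ => by positivity)).trans ?_
      rw [Finset.sum_sigma]
      have hcard : ∀ t : ℕ, (Fintype.card
          (Fin (2 * t) × (Fin (2 * t) → Fin D) × (Fin (2 * t) → Fin D)) : ℝ)
          = (2 * t) * (D : ℝ) ^ (4 * t) := by
        intro t
        simp only [Fintype.card_prod, Fintype.card_fin, Fintype.card_fun]
        push_cast
        rw [← pow_add]
        congr 2
        omega
      have h4 : ∀ t ∈ Finset.Icc 1 (H * Fintype.card V),
          ∑ x : Fin (2 * t) × (Fin (2 * t) → Fin D) × (Fin (2 * t) → Fin D), B ^ H / B ^ t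
          = B ^ H * (((2 * t : ℝ) * (D : ℝ) ^ (4 * t)) / (8 * (D : ℝ) ^ 4) ^ t) := by
        intro t _
        rw [Finset.sum_const, nsmul_eq_mul, Finset.card_univ, hcard, ← hB]
        ring
      rw [Finset.sum_congr rfl h4, ← Finset.mul_sum]
      have h5 := mul_le_mul_of_nonneg_left (sum_weights_le D (H * Fintype.card V) hD)
        (show 0 ≤ B ^ H by positivity)
      have h6 : ((Fintype.card (Fin (2 * (8 * D ^ 4) ^ H)) : ℕ) : ℝ) = 2 * B ^ H := by
        rw [Fintype.card_fin, hB]; push_cast; ring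
      rw [h6]
      linarith

/-! ### Proper colourings and square-free words -/

/-- Greedy colouring: a symmetric relation contained in a bounded out-degree relation has a proper
colouring with a bounded number of colours. -/
theorem exists_proper (K : Type) [Fintype K] (V : Type) [Fintype V] [DecidableEq V] (q : V → V → Prop)
    (nb : V → K → V) (hnb : ∀ v w, q v w → ∃ k, nb v k = w) (hsymm : ∀ v w, q v w → q w v)
    (hirr : ∀ v, ¬ q v v) :
    ∃ f : V → Fin (Fintype.card K + 1), ∀ v w, q v w → f v ≠ f w := by
  let E := {e : V × V // q e.1 e.2}
  have key := exists_avoiding (C := Fin (Fintype.card K + 1)) (E := E) 1 one_pos (fun e => {e.1.1, e.1.2})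
    (fun e => {f | f e.1.1 = f e.1.2}) (fun e => by simp) ?_ ?_
  · obtain ⟨f, hf⟩ := key
    exact ⟨f, fun v w h => hf ⟨(v, w), h⟩⟩
  · rintro ⟨⟨a, b⟩, h⟩ f f' hff hf
    simp only [Set.mem_ofPred_eq] at hf ⊢
    rw [← hff a (by simp), ← hff b (by simp), hf]
  · intro v
    -- With `β = 1` every weight is 1, one for each index. Entries with `nb v k = v` are excluded,
    -- since there the equality of colours determines nothing.
    refine ⟨K, Finset.univ, fun _ => {v}, fun k => {f | nb v k ≠ v ∧ f v = f (nb v k)},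
      ?_, ?_, ?_⟩
    · rintro ⟨⟨a, b⟩, h⟩ f hv hf
      simp only [Finset.mem_insert, Finset.mem_singleton] at hv
      simp only [Set.mem_ofPred_eq] at hf
      have hab : a ≠ b := fun e => hirr a (by simpa [← e] using h)
      rcases hv with rfl | rfl
      · obtain ⟨k, hk⟩ := hnb _ _ h
        simp only at hk
        exact ⟨k, Finset.mem_univ _, by simp [hk, hf, hab.symm], by simp⟩
      · obtain ⟨k, hk⟩ := hnb _ _ (hsymm _ _ h)
        simp only at hk
        exact ⟨k, Finset.mem_univ _, by simp [hk, hf, hab], by simp⟩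
    · intro k _
      refine ⟨by simp, fun f f' hf hf' h => ?_⟩
      simp only [Set.mem_ofPred_eq, Finset.mem_singleton] at hf hf' h
      funext x
      by_cases hx : x = v
      · subst hx; rw [hf.2, hf'.2, h _ hf.1]
      · exact h x hx
    · simp

/-- A bounded alphabet carries arbitrarily long square-free words. -/
theorem exists_squarefree_word :
    ∃ c : ℕ, 0 < c ∧ ∀ n : ℕ, ∃ τ : ℕ → Fin c, ∀ a k : ℕ, 1 ≤ k → a + 2 * k ≤ n →
      ¬ ∀ i < k, τ (a + i) = τ (a + k + i) := by
  obtain ⟨c, hc, h⟩ := exists_no_short_repetition 2 1 (by norm_num)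
  refine ⟨c, hc, fun n => ?_⟩
  -- Factors of the word are subpaths of the path on `0, …, n`, whose length equals their order, so
  -- `H = 1` suffices. Wrapped or truncated entries at the ends are harmless extra list entries.
  let nb : Fin (n + 1) → Fin 2 → Fin (n + 1) := fun x k =>
    if k = 0 then Fin.ofNat (n + 1) (x + 1) else Fin.ofNat (n + 1) (x - 1)
  have hnb : ∀ x y : Fin (n + 1), ((y : ℕ) = x + 1 ∨ (x : ℕ) = y + 1) → ∃ k, nb x k = y := by
    rintro x y (h | h)
    · refine ⟨0, ?_⟩
      ext
      simp only [nb, if_true, Fin.val_ofNat]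
      rw [← h]
      exact Nat.mod_eq_of_lt y.2
    · refine ⟨1, ?_⟩
      ext
      simp only [nb, Fin.val_ofNat, one_ne_zero, if_false]
      rw [h, Nat.add_sub_cancel]
      exact Nat.mod_eq_of_lt y.2
  obtain ⟨f, hf⟩ := h (Fin (n + 1)) _ nb hnb (fun x y h => h.symm)
  refine ⟨fun i => f (Fin.ofNat (n + 1) i), fun a k hk hak hsq => ?_⟩
  have hval : ∀ i, i < 2 * k → (Fin.ofNat (n + 1) (a + i)).val = a + i := by
    intro i hi
    simp only [Fin.val_ofNat]
    exact Nat.mod_eq_of_lt (by omega)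
  have hinj : Set.InjOn (fun i => Fin.ofNat (n + 1) (a + i)) (Finset.range (2 * k)) := by
    intro i hi j hj hij
    simp only [Finset.coe_range, Set.mem_Iio] at hi hj
    have := congrArg Fin.val hij
    simp only [hval i hi, hval j hj] at this
    omega
  refine hf k (fun i => Fin.ofNat (n + 1) (a + i)) hk ?_ ?_ ?_ ?_
  · intro i hi
    left
    rw [hval i (by omega), hval (i + 1) hi]
    omega
  · intro i hi heq
    have := congrArg Fin.val heq
    rw [hval i (by omega), hval (k + i) (by omega)] at this
    omega
  · rw [Finset.card_image_of_injOn hinj]; simp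
  · intro i hi
    have := hsq i hi
    rwa [add_assoc] at this

/-! ### The subdivided graph and its colouring -/

/-- The vertices of the graph obtained by subdividing each edge `N` times. The vertex `inl v` is
the original vertex `v`; of the vertices `inr (v, w, d)` only those with `1 ≤ d ≤ N` and `vw` an
edge oriented by its colours are used, and the others are isolated. -/
abbrev SubdVertex (V : Type) (N : ℕ) : Type := V ⊕ (V × V × Fin (N + 2))

section Subdivision

variable {V : Type} {c N b : ℕ} (G : SimpleGraph V) (g : V → Fin c) (ψ : V → Fin N) (τ : ℕ → Fin b)

/-- The vertex at distance `d` from `v` on the subdivided edge `vw`. -/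
def pt (N : ℕ) (v w : V) (d : ℕ) : SubdVertex V N :=
  if d = 0 then .inl v
  else if N < d then .inl w
  else if g v < g w then .inr (v, w, Fin.ofNat (N + 2) d)
  else .inr (w, v, Fin.ofNat (N + 2) (N + 1 - d))

/-- The graph obtained from `G` by subdividing each edge `N` times. -/
def subdivision (N : ℕ) : SimpleGraph (SubdVertex V N) :=
  SimpleGraph.fromRel fun x y =>
    ∃ v w d, G.Adj v w ∧ d ≤ N ∧ x = pt g N v w d ∧ y = pt g N v w (d + 1)

/-- The colours used on the subdivided graph; their number does not depend on `N`. -/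
abbrev SubdColour (c b : ℕ) : Type := Fin c ⊕ (Fin c × Fin c × Fin b × Fin 3 × Bool × Bool)

/-- The colouring of the subdivided graph. The subdivision vertices of an edge `vw` show the
colours `g v` and `g w`, a letter of the word `τ`, their position modulo 3, and one bit each of the
unary codes of `ψ v` and `ψ w`. -/
def subdColouring : SubdVertex V N → SubdColour c b
  | .inl v => .inl (g v)
  | .inr (v, w, d) => .inr (g v, g w, τ d, Fin.ofNat 3 d, decide ((ψ v : ℕ) + 1 = d),
      decide ((ψ w : ℕ) + 1 = d))

theorem pt_zero (v w : V) : pt g N v w 0 = .inl v := by simp [pt]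

theorem pt_last (v w : V) : pt g N v w (N + 1) = .inl w := by simp [pt]

theorem pt_of_lt {v w : V} {d : ℕ} (h1 : 1 ≤ d) (h2 : d ≤ N) (h : g v < g w) :
    pt g N v w d = .inr (v, w, Fin.ofNat (N + 2) d) := by
  simp [pt, h, show d ≠ 0 by omega, show ¬ N < d by omega]

theorem pt_of_gt {v w : V} {d : ℕ} (h1 : 1 ≤ d) (h2 : d ≤ N) (h : g w < g v) :
    pt g N v w d = .inr (w, v, Fin.ofNat (N + 2) (N + 1 - d)) := by
  simp [pt, not_lt.2 h.le, show d ≠ 0 by omega, show ¬ N < d by omega]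

theorem pt_ne_inl {v w x : V} {d : ℕ} (h1 : 1 ≤ d) (h2 : d ≤ N) : pt g N v w d ≠ .inl x := by
  simp only [pt, show d ≠ 0 by omega, show ¬ N < d by omega, if_false]
  split_ifs <;> simp

/-- Both readings of an edge name the same vertex because the stored orientation is decided by `g`;
this needs different colours at the ends. -/
theorem pt_symm {v w : V} {d : ℕ} (hvw : g v ≠ g w) (hd : d ≤ N + 1) :
    pt g N w v (N + 1 - d) = pt g N v w d := by
  rcases Nat.eq_zero_or_pos d with rfl | h1
  · simp [pt]
  rcases Nat.lt_or_ge N d with h2 | h2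
  · obtain rfl : d = N + 1 := by omega
    simp [pt]
  rcases lt_or_gt_of_ne hvw with h | h
  · rw [pt_of_lt g h1 h2 h, pt_of_gt g (by omega) (by omega) h,
      show N + 1 - (N + 1 - d) = d by omega]
  · rw [pt_of_gt g h1 h2 h, pt_of_lt g (by omega) (by omega) h]

theorem pt_eq_inl {v w x : V} {d : ℕ} (hd : d ≤ N + 1) (h : pt g N v w d = .inl x) :
    (d = 0 ∧ v = x) ∨ (d = N + 1 ∧ w = x) := by
  rcases Nat.eq_zero_or_pos d with rfl | h1
  · left; simpa [pt] using h
  rcases Nat.lt_or_ge N d with h2 | h2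
  · obtain rfl : d = N + 1 := by omega
    right; simpa [pt] using h
  · exact absurd h (pt_ne_inl g h1 h2)

theorem ofNat_inj {n d e : ℕ} (hd : d < n + 2) (he : e < n + 2)
    (h : Fin.ofNat (n + 2) d = Fin.ofNat (n + 2) e) : d = e := by
  have := congrArg Fin.val h
  simpa [Fin.val_ofNat, Nat.mod_eq_of_lt hd, Nat.mod_eq_of_lt he] using this

theorem pt_eq_pt {v w v' w' : V} {d d' : ℕ} (hvw : g v ≠ g w) (hvw' : g v' ≠ g w')
    (h1 : 1 ≤ d) (h2 : d ≤ N) (hd' : d' ≤ N + 1) (h : pt g N v w d = pt g N v' w' d') :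
    (v' = v ∧ w' = w ∧ d' = d) ∨ (v' = w ∧ w' = v ∧ d' = N + 1 - d) := by
  have h1' : 1 ≤ d' := by
    by_contra hc
    obtain rfl : d' = 0 := by omega
    rw [pt_zero] at h
    exact pt_ne_inl g h1 h2 h
  have h2' : d' ≤ N := by
    by_contra hc
    obtain rfl : d' = N + 1 := by omega
    rw [pt_last] at h
    exact pt_ne_inl g h1 h2 h
  rcases lt_or_gt_of_ne hvw with hh | hh <;> rcases lt_or_gt_of_ne hvw' with hh' | hh'
  · rw [pt_of_lt g h1 h2 hh, pt_of_lt g h1' h2' hh', Sum.inr.injEq, Prod.mk.injEq,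
      Prod.mk.injEq] at h
    obtain ⟨rfl, rfl, h⟩ := h
    exact .inl ⟨rfl, rfl, (ofNat_inj (by omega) (by omega) h).symm⟩
  · rw [pt_of_lt g h1 h2 hh, pt_of_gt g h1' h2' hh', Sum.inr.injEq, Prod.mk.injEq,
      Prod.mk.injEq] at h
    obtain ⟨rfl, rfl, h⟩ := h
    have := ofNat_inj (by omega) (by omega) h
    exact .inr ⟨rfl, rfl, by omega⟩
  · rw [pt_of_gt g h1 h2 hh, pt_of_lt g h1' h2' hh', Sum.inr.injEq, Prod.mk.injEq,
      Prod.mk.injEq] at h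
    obtain ⟨rfl, rfl, h⟩ := h
    have := ofNat_inj (by omega) (by omega) h
    exact .inr ⟨rfl, rfl, by omega⟩
  · rw [pt_of_gt g h1 h2 hh, pt_of_gt g h1' h2' hh', Sum.inr.injEq, Prod.mk.injEq,
      Prod.mk.injEq] at h
    obtain ⟨rfl, rfl, h⟩ := h
    have := ofNat_inj (by omega) (by omega) h
    exact .inl ⟨rfl, rfl, by omega⟩

theorem pt_inj {v w : V} {d d' : ℕ} (hvw : g v ≠ g w) (h1 : 1 ≤ d) (h2 : d ≤ N) (hd' : d' ≤ N + 1)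
    (h : pt g N v w d = pt g N v w d') : d' = d := by
  rcases pt_eq_pt g hvw hvw h1 h2 hd' h with h | h
  · exact h.2.2
  · exact absurd (congrArg g h.1) hvw

theorem colour_of_lt {v w : V} {d : ℕ} (h1 : 1 ≤ d) (h2 : d ≤ N) (h : g v < g w) :
    subdColouring g ψ τ (pt g N v w d) = .inr (g v, g w, τ d, Fin.ofNat 3 d,
      decide ((ψ v : ℕ) + 1 = d), decide ((ψ w : ℕ) + 1 = d)) := by
  rw [pt_of_lt g h1 h2 h]
  simp only [subdColouring, Fin.val_ofNat, Nat.mod_eq_of_lt (show d < N + 2 by omega)]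

theorem colour_of_gt {v w : V} {d : ℕ} (h1 : 1 ≤ d) (h2 : d ≤ N) (h : g w < g v) :
    subdColouring g ψ τ (pt g N v w d) = .inr (g w, g v, τ (N + 1 - d), Fin.ofNat 3 (N + 1 - d),
      decide ((ψ w : ℕ) + 1 = N + 1 - d), decide ((ψ v : ℕ) + 1 = N + 1 - d)) := by
  rw [pt_of_gt g h1 h2 h]
  simp only [subdColouring, Fin.val_ofNat, Nat.mod_eq_of_lt (show N + 1 - d < N + 2 by omega)]

/-- Subdivision vertices and original vertices have different colours. -/
theorem colour_inl_of_eq {x y : SubdVertex V N} {v : V}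
    (h : subdColouring g ψ τ x = subdColouring g ψ τ y) (hx : x = .inl v) :
    ∃ v', y = .inl v' ∧ g v = g v' := by
  subst hx
  rcases y with v' | ⟨v', w', d⟩
  · exact ⟨v', rfl, by simpa [subdColouring] using h⟩
  · simp [subdColouring] at h

/-- The orientation is read off from `g`, so colours along an edge depend only on `g` and `ψ` at its
ends. This makes lifted walks repetitive. -/
theorem colour_pt_congr {v w v' w' : V} (d : ℕ) (hv : g v = g v') (hw : g w = g w')
    (hψv : ψ v = ψ v') (hψw : ψ w = ψ w') :
    subdColouring g ψ τ (pt g N v w d) = subdColouring g ψ τ (pt g N v' w' d) := by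
  simp only [pt, hv, hw]
  split_ifs <;> simp [subdColouring, hv, hw, hψv, hψw]

/-- Edges with the same end colours are oriented alike, so the stored residues can be compared from
either end. With unit steps this forces the two halves of a repetition to move in the same
direction. -/
theorem mod_three_of_colour {v w v' w' : V} {d d' : ℕ} (hvw : g v ≠ g w) (hv : g v = g v')
    (hw : g w = g w') (hd : d ≤ N + 1) (hd' : d' ≤ N + 1)
    (h : subdColouring g ψ τ (pt g N v w d) = subdColouring g ψ τ (pt g N v' w' d')) :
    d % 3 = d' % 3 := by
  rcases Nat.eq_zero_or_pos d with rfl | h1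
  · obtain ⟨x, hx, hg⟩ := colour_inl_of_eq g ψ τ h (pt_zero g v w)
    rcases pt_eq_inl g hd' hx with ⟨rfl, -⟩ | ⟨-, rfl⟩
    · rfl
    · exact absurd (hg.trans hw.symm) hvw
  rcases Nat.lt_or_ge N d with h2 | h2
  · obtain rfl : d = N + 1 := by omega
    obtain ⟨x, hx, hg⟩ := colour_inl_of_eq g ψ τ h (pt_last g v w)
    rcases pt_eq_inl g hd' hx with ⟨-, rfl⟩ | ⟨rfl, -⟩
    · exact absurd (hg.trans hv.symm).symm hvw
    · rfl
  have h1' : 1 ≤ d' := by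
    by_contra hc
    obtain rfl : d' = 0 := by omega
    obtain ⟨x, hx, -⟩ := colour_inl_of_eq g ψ τ h.symm (pt_zero g v' w')
    exact pt_ne_inl g h1 h2 hx
  have h2' : d' ≤ N := by
    by_contra hc
    obtain rfl : d' = N + 1 := by omega
    obtain ⟨x, hx, -⟩ := colour_inl_of_eq g ψ τ h.symm (pt_last g v' w')
    exact pt_ne_inl g h1 h2 hx
  rcases lt_or_gt_of_ne hvw with hh | hh
  · rw [colour_of_lt g ψ τ h1 h2 hh, colour_of_lt g ψ τ h1' h2' (by rwa [← hv, ← hw])] at h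
    simp only [Sum.inr.injEq, Prod.mk.injEq] at h
    simpa using congrArg Fin.val h.2.2.2.1
  · rw [colour_of_gt g ψ τ h1 h2 hh, colour_of_gt g ψ τ h1' h2' (by rwa [← hv, ← hw])] at h
    simp only [Sum.inr.injEq, Prod.mk.injEq] at h
    have : (N + 1 - d) % 3 = (N + 1 - d') % 3 := by simpa using congrArg Fin.val h.2.2.2.1
    omega

/-- A subdivision vertex shows the colours of both ends of its edge; knowing one of them leaves the
other. -/
theorem colour_first {v w v' w' : V} {d d' : ℕ} (hvw : g v ≠ g w) (hvw' : g v' ≠ g w')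
    (hv : g v = g v') (h1 : 1 ≤ d) (h2 : d ≤ N) (h1' : 1 ≤ d') (h2' : d' ≤ N)
    (h : subdColouring g ψ τ (pt g N v w d) = subdColouring g ψ τ (pt g N v' w' d')) :
    g w = g w' := by
  rcases lt_or_gt_of_ne hvw with hh | hh <;> rcases lt_or_gt_of_ne hvw' with hh' | hh'
  · rw [colour_of_lt g ψ τ h1 h2 hh, colour_of_lt g ψ τ h1' h2' hh'] at h
    simp only [Sum.inr.injEq, Prod.mk.injEq] at h
    exact h.2.1
  · rw [colour_of_lt g ψ τ h1 h2 hh, colour_of_gt g ψ τ h1' h2' hh'] at h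
    simp only [Sum.inr.injEq, Prod.mk.injEq] at h
    rw [← h.1, hv] at hh'
    exact absurd hh' (lt_irrefl _)
  · rw [colour_of_gt g ψ τ h1 h2 hh, colour_of_lt g ψ τ h1' h2' hh'] at h
    simp only [Sum.inr.injEq, Prod.mk.injEq] at h
    rw [h.1, hv] at hh
    exact absurd hh (lt_irrefl _)
  · rw [colour_of_gt g ψ τ h1 h2 hh, colour_of_gt g ψ τ h1' h2' hh'] at h
    simp only [Sum.inr.injEq, Prod.mk.injEq] at h
    exact h.1

/-- The unary mark of an end lies at position `ψ + 1` along the orientation, which is at most `N`,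
so the interior of an edge reveals `ψ` at both ends. -/
theorem colour_bits {v w v' w' : V} (hvw : g v ≠ g w) (hv : g v = g v') (hw : g w = g w')
    (h : ∀ l, 1 ≤ l → l ≤ N →
      subdColouring g ψ τ (pt g N v w l) = subdColouring g ψ τ (pt g N v' w' l)) :
    ψ v = ψ v' ∧ ψ w = ψ w' := by
  have hv2 := (ψ v).2
  have hw2 := (ψ w).2
  rcases lt_or_gt_of_ne hvw with hh | hh
  · have key : ∀ l, 1 ≤ l → l ≤ N → (((ψ v : ℕ) + 1 = l ↔ (ψ v' : ℕ) + 1 = l) ∧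
        ((ψ w : ℕ) + 1 = l ↔ (ψ w' : ℕ) + 1 = l)) := by
      intro l h1 h2
      have := h l h1 h2
      rw [colour_of_lt g ψ τ h1 h2 hh, colour_of_lt g ψ τ h1 h2 (by rwa [← hv, ← hw])] at this
      simp only [Sum.inr.injEq, Prod.mk.injEq, decide_eq_decide] at this
      exact this.2.2.2.2
    have e1 := (key (ψ v + 1) (by omega) (by omega)).1.1 rfl
    have e2 := (key (ψ w + 1) (by omega) (by omega)).2.1 rfl
    exact ⟨Fin.ext (by omega), Fin.ext (by omega)⟩
  · have key : ∀ l, 1 ≤ l → l ≤ N →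
        (((ψ w : ℕ) + 1 = N + 1 - l ↔ (ψ w' : ℕ) + 1 = N + 1 - l) ∧
        ((ψ v : ℕ) + 1 = N + 1 - l ↔ (ψ v' : ℕ) + 1 = N + 1 - l)) := by
      intro l h1 h2
      have := h l h1 h2
      rw [colour_of_gt g ψ τ h1 h2 hh, colour_of_gt g ψ τ h1 h2 (by rwa [← hv, ← hw])] at this
      simp only [Sum.inr.injEq, Prod.mk.injEq, decide_eq_decide] at this
      exact this.2.2.2.2
    have e1 := (key (N - ψ v) (by omega) (by omega)).2.1 (by omega)
    have e2 := (key (N - ψ w) (by omega) (by omega)).1.1 (by omega)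
    exact ⟨Fin.ext (by omega), Fin.ext (by omega)⟩

/-- Letters follow the orientation by `g`, so an edge read against it shows `τ` backwards. -/
theorem colour_word {v w : V} {d d' : ℕ} (hvw : g v ≠ g w) (h1 : 1 ≤ d) (h2 : d ≤ N)
    (h1' : 1 ≤ d') (h2' : d' ≤ N)
    (h : subdColouring g ψ τ (pt g N v w d) = subdColouring g ψ τ (pt g N v w d')) :
    if g v < g w then τ d = τ d' else τ (N + 1 - d) = τ (N + 1 - d') := by
  rcases lt_or_gt_of_ne hvw with hh | hh
  · rw [colour_of_lt g ψ τ h1 h2 hh, colour_of_lt g ψ τ h1' h2' hh] at h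
    simp only [Sum.inr.injEq, Prod.mk.injEq] at h
    simpa [hh] using h.2.2.1
  · rw [colour_of_gt g ψ τ h1 h2 hh, colour_of_gt g ψ τ h1' h2' hh] at h
    simp only [Sum.inr.injEq, Prod.mk.injEq] at h
    simpa [not_lt.2 hh.le] using h.2.2.1

section Adjacency

variable {G g} (hg1 : ∀ v w, G.Adj v w → g v ≠ g w)
include hg1

/-- The defining relation is already symmetric, by reading the edge from its other end, and
irreflexive, so `fromRel` adds nothing. -/
theorem subdivision_adj {x y : SubdVertex V N} : (subdivision G g N).Adj x y ↔
    ∃ v w d, G.Adj v w ∧ d ≤ N ∧ x = pt g N v w d ∧ y = pt g N v w (d + 1) := by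
  simp only [subdivision, SimpleGraph.fromRel_adj]
  constructor
  · rintro ⟨-, h | ⟨v, w, d, h, hd, rfl, rfl⟩⟩
    · exact h
    · refine ⟨w, v, N - d, h.symm, by omega, ?_, ?_⟩
      · rw [← pt_symm g (hg1 v w h) (by omega), show N + 1 - (d + 1) = N - d by omega]
      · rw [← pt_symm g (hg1 v w h) (by omega), show N + 1 - d = N - d + 1 by omega]
  · rintro ⟨v, w, d, h, hd, rfl, rfl⟩
    refine ⟨fun heq => ?_, .inl ⟨v, w, d, h, hd, rfl, rfl⟩⟩
    rcases Nat.eq_zero_or_pos d with rfl | h1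
    · rw [pt_zero] at heq
      rcases pt_eq_inl g (by omega) heq.symm with ⟨h0, -⟩ | ⟨-, rfl⟩
      · omega
      · exact G.loopless.irrefl _ h
    · have := pt_inj g (hg1 v w h) h1 hd (by omega) heq
      omega

theorem adj_pt {v w : V} {d : ℕ} (h : G.Adj v w) (hd : d ≤ N) :
    (subdivision G g N).Adj (pt g N v w d) (pt g N v w (d + 1)) :=
  (subdivision_adj hg1).2 ⟨v, w, d, h, hd, rfl, rfl⟩

theorem adj_inl {v : V} {y : SubdVertex V N} (h : (subdivision G g N).Adj (.inl v) y) :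
    ∃ w, G.Adj v w ∧ y = pt g N v w 1 := by
  obtain ⟨a, b, e, hab, he, hx, rfl⟩ := (subdivision_adj hg1).1 h
  rcases pt_eq_inl g (by omega) hx.symm with ⟨rfl, rfl⟩ | ⟨rfl, -⟩
  · exact ⟨b, hab, rfl⟩
  · omega

theorem adj_inner {v w : V} {d : ℕ} {y : SubdVertex V N} (hvw : G.Adj v w) (h1 : 1 ≤ d)
    (h2 : d ≤ N) (h : (subdivision G g N).Adj (pt g N v w d) y) :
    y = pt g N v w (d - 1) ∨ y = pt g N v w (d + 1) := by
  obtain ⟨a, b, e, hab, he, hx, rfl⟩ := (subdivision_adj hg1).1 h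
  rcases pt_eq_pt g (hg1 v w hvw) (hg1 a b hab) h1 h2 (by omega) hx with
    ⟨rfl, rfl, rfl⟩ | ⟨rfl, rfl, rfl⟩
  · exact .inr rfl
  · left
    rw [← pt_symm g (hg1 _ _ hvw) (by omega)]
    congr 1
    omega

/-- Adjacent vertices, and distinct vertices with a common neighbour, get different colours. -/
theorem subdColouring_adj_ne {x y : SubdVertex V N} (h : (subdivision G g N).Adj x y) :
    subdColouring g ψ τ x ≠ subdColouring g ψ τ y := by
  obtain ⟨v, w, d, hvw, hd, rfl, rfl⟩ := (subdivision_adj hg1).1 h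
  intro heq
  have := mod_three_of_colour g ψ τ (hg1 v w hvw) rfl rfl (by omega) (by omega) heq
  omega

/-- Around an original vertex the neighbours show the far ends, which `g` separates; inside an edge
the neighbours are two positions apart and differ modulo 3. -/
theorem subdColouring_common_ne (hN : 0 < N)
    (hg2 : ∀ u v w, G.Adj u v → G.Adj u w → v ≠ w → g v ≠ g w)
    {x y z : SubdVertex V N} (hy : (subdivision G g N).Adj x y)
    (hz : (subdivision G g N).Adj x z) (heq : subdColouring g ψ τ y = subdColouring g ψ τ z) :
    y = z := by
  obtain ⟨v, w, d, hvw, hd, rfl, -⟩ := (subdivision_adj hg1).1 hy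
  rcases Nat.eq_zero_or_pos d with rfl | h1
  · rw [pt_zero] at hy hz
    obtain ⟨a, ha, rfl⟩ := adj_inl hg1 hy
    obtain ⟨a', ha', rfl⟩ := adj_inl hg1 hz
    have := colour_first g ψ τ (hg1 _ _ ha) (hg1 _ _ ha') rfl le_rfl hN le_rfl hN heq
    by_cases h : a = a'
    · rw [h]
    · exact absurd this (hg2 _ _ _ ha ha' h)
  · rcases adj_inner hg1 hvw h1 hd hy with rfl | rfl <;>
      rcases adj_inner hg1 hvw h1 hd hz with rfl | rfl
    · rfl
    · have := mod_three_of_colour g ψ τ (hg1 v w hvw) rfl rfl (by omega) (by omega) heq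
      omega
    · have := mod_three_of_colour g ψ τ (hg1 v w hvw) rfl rfl (by omega) (by omega) heq
      omega
    · rfl

end Adjacency

end Subdivision

/-! ### Squares from walks on the integers -/

/-- Discrete intermediate value theorem. -/
theorem exists_eq_of_steps (d : ℕ → ℤ) (n : ℕ) (y : ℤ)
    (hd : ∀ i < n, d (i + 1) = d i + 1 ∨ d (i + 1) = d i - 1) (h0 : d 0 ≤ y) (hn : y ≤ d n) :
    ∃ i ≤ n, d i = y := by
  induction n with
  | zero => exact ⟨0, le_rfl, by omega⟩
  | succ n ih =>
    by_cases h : y ≤ d n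
    · obtain ⟨i, hi, h⟩ := ih (fun i hi => hd i (by omega)) h
      exact ⟨i, by omega, h⟩
    · refine ⟨n + 1, le_rfl, ?_⟩
      have := hd n (by omega)
      omega

/-- If a walk on the integers consists of two halves that are translates of each other, then it
visits two consecutive intervals that are translates of each other. -/
theorem exists_square_of_translate (d : ℕ → ℤ) (t : ℕ) (ht : 1 ≤ t) (δ : ℤ) (hδ : δ ≠ 0)
    (hd : ∀ i, i + 1 < 2 * t → d (i + 1) = d i + 1 ∨ d (i + 1) = d i - 1)
    (htr : ∀ i < t, d (t + i) = d i + δ) :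
    ∃ (a : ℤ) (k : ℕ), 1 ≤ k ∧ ∀ j < k, ∃ i < t, (d i = a + j ∧ d (t + i) = a + k + j) ∨
      (d (t + i) = a + j ∧ d i = a + k + j) := by
  -- The first half ends one step from `d t = d 0 + δ`, so it covers `|δ|` consecutive integers
  -- starting with `d 0` in the direction of `δ`.
  have hmid := hd (t - 1) (by omega)
  rw [show t - 1 + 1 = t + 0 by omega, htr 0 (by omega)] at hmid
  rcases lt_or_gt_of_ne hδ with h | h
  · obtain ⟨k, hk⟩ : ∃ k : ℕ, δ = -k := ⟨δ.natAbs, by omega⟩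
    refine ⟨d 0 - 2 * k + 1, k, by omega, fun j hj => ?_⟩
    obtain ⟨i, hi, he⟩ := exists_eq_of_steps (fun i => - d i) (t - 1) (-(d 0 - k + 1 + j))
      (fun i hi => by have := hd i (by omega); omega) (by omega) (by omega)
    refine ⟨i, by omega, .inr ?_⟩
    have := htr i (by omega)
    constructor <;> omega
  · obtain ⟨k, hk⟩ : ∃ k : ℕ, δ = k := ⟨δ.natAbs, by omega⟩
    refine ⟨d 0, k, by omega, fun j hj => ?_⟩
    obtain ⟨i, hi, he⟩ := exists_eq_of_steps d (t - 1) (d 0 + j)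
      (fun i hi => hd i (by omega)) (by omega) (by omega)
    refine ⟨i, by omega, .inl ?_⟩
    have := htr i (by omega)
    constructor <;> omega

/-! ### Projecting repetitions to the original graph -/

section Extraction

variable {V : Type} {c N b : ℕ} {G : SimpleGraph V} {g : V → Fin c} (ψ : V → Fin N)
  (τ : ℕ → Fin b) (hN : 0 < N) (hg1 : ∀ v w, G.Adj v w → g v ≠ g w)

include hg1 in
/-- A repetition in the subdivided graph whose halves have no common positions visits an original
vertex. -/
theorem exists_original_of_repetition
    (hτ : ∀ a k : ℕ, 1 ≤ k → a + 2 * k ≤ N + 1 → ¬ ∀ i < k, τ (a + i) = τ (a + k + i))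
    (t : ℕ) (u : ℕ → SubdVertex V N) (ht : 1 ≤ t)
    (hadj : ∀ i, i + 1 < 2 * t → (subdivision G g N).Adj (u i) (u (i + 1)))
    (hcol : ∀ i < t, subdColouring g ψ τ (u i) = subdColouring g ψ τ (u (t + i)))
    (hne : ∀ i < t, u i ≠ u (t + i)) : ∃ i < t, ∃ x, u i = .inl x := by
  by_contra hcon
  push Not at hcon
  have hcore : ∀ i < 2 * t, ∀ x, u i ≠ .inl x := by
    intro i hi x hx
    by_cases hit : i < t
    · exact hcon i hit x hx
    · obtain ⟨j, rfl⟩ : ∃ j, i = t + j := ⟨i - t, by omega⟩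
      obtain ⟨y, hy, -⟩ := colour_inl_of_eq g ψ τ (hcol j (by omega)).symm hx
      exact hcon j (by omega) y hy
  obtain ⟨v, w, d0, hvw, hd0, h0, -⟩ := (subdivision_adj hg1).1 (hadj 0 (by omega))
  have hgvw := hg1 v w hvw
  have hpos : ∀ i, i < 2 * t → ∃ d, 1 ≤ d ∧ d ≤ N ∧ u i = pt g N v w d := by
    intro i
    induction i with
    | zero =>
      intro _
      refine ⟨d0, ?_, hd0, h0⟩
      by_contra h
      obtain rfl : d0 = 0 := by omega
      rw [pt_zero] at h0
      exact hcore 0 (by omega) _ h0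
    | succ i ih =>
      intro hi
      obtain ⟨d, h1, h2, h3⟩ := ih (by omega)
      have ha := hadj i hi
      rw [h3] at ha
      rcases adj_inner hg1 hvw h1 h2 ha with h | h
      · refine ⟨d - 1, ?_, by omega, h⟩
        by_contra hc
        rw [show d - 1 = 0 by omega, pt_zero] at h
        exact hcore _ hi _ h
      · refine ⟨d + 1, by omega, ?_, h⟩
        by_contra hc
        rw [show d + 1 = N + 1 by omega, pt_last] at h
        exact hcore _ hi _ h
  choose! d hd1 hd2 hd3 using hpos
  have hstep : ∀ i, i + 1 < 2 * t → d (i + 1) = d i + 1 ∨ d (i + 1) + 1 = d i := by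
    intro i hi
    have ha := hadj i hi
    rw [hd3 i (by omega)] at ha
    have p1 := hd1 i (by omega)
    have p2 := hd2 i (by omega)
    have p3 := hd1 (i + 1) hi
    have p4 := hd2 (i + 1) hi
    rcases adj_inner hg1 hvw p1 p2 ha with h | h
    · rw [hd3 (i + 1) hi] at h
      have := pt_inj g hgvw p3 p4 (by omega) h
      omega
    · rw [hd3 (i + 1) hi] at h
      have := pt_inj g hgvw p3 p4 (by omega) h
      omega
  have hcol' : ∀ i < t, subdColouring g ψ τ (pt g N v w (d i))
      = subdColouring g ψ τ (pt g N v w (d (t + i))) := by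
    intro i hi
    rw [← hd3 i (by omega), ← hd3 (t + i) (by omega)]
    exact hcol i hi
  have hmod : ∀ i < t, d i % 3 = d (t + i) % 3 := by
    intro i hi
    have p2 := hd2 i (by omega)
    have p4 := hd2 (t + i) (by omega)
    exact mod_three_of_colour g ψ τ hgvw rfl rfl (by omega) (by omega) (hcol' i hi)
  -- Positions agree modulo 3 and steps are `±1`, so both halves step alike and the displacement is
  -- constant.
  have htr : ∀ i < t, (d (t + i) : ℤ) = d i + ((d t : ℤ) - d 0) := by
    intro i
    induction i with
    | zero => intro _; simp
    | succ i ih =>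
      intro hi
      have e1 := ih (by omega)
      have e2 := hstep i (by omega)
      have e3 := hstep (t + i) (by omega)
      have e4 := hmod i (by omega)
      have e5 := hmod (i + 1) hi
      rw [← add_assoc] at e5 ⊢
      omega
  have hδ : (d t : ℤ) - d 0 ≠ 0 := by
    intro h
    refine hne 0 (by omega) ?_
    rw [hd3 0 (by omega), hd3 (t + 0) (by omega)]
    congr 1
    simp only [add_zero]
    omega
  obtain ⟨a, k, hk, hsq⟩ := exists_square_of_translate (fun i => (d i : ℤ)) t ht _ hδ
    (fun i hi => by have := hstep i hi; omega) htr
  have hword : ∀ j < k, ∃ p : ℕ, (p : ℤ) = a + j ∧ 1 ≤ p ∧ p + k ≤ N ∧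
      subdColouring g ψ τ (pt g N v w p) = subdColouring g ψ τ (pt g N v w (p + k)) := by
    intro j hj
    obtain ⟨i, hi, ⟨e1, e2⟩ | ⟨e1, e2⟩⟩ := hsq j hj
    · have p1 := hd1 i (by omega)
      have p2 := hd2 (t + i) (by omega)
      refine ⟨d i, e1, p1, by omega, ?_⟩
      rw [hcol' i hi]
      congr 2
      omega
    · have p1 := hd1 (t + i) (by omega)
      have p2 := hd2 i (by omega)
      refine ⟨d (t + i), e1, p1, by omega, ?_⟩
      rw [← hcol' i hi]
      congr 2
      omega
  obtain ⟨p0, hp0, hp1, hp2, -⟩ := hword 0 (by omega)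
  have hword' : ∀ j < k, p0 + j + k ≤ N ∧ subdColouring g ψ τ (pt g N v w (p0 + j))
      = subdColouring g ψ τ (pt g N v w (p0 + j + k)) := by
    intro j hj
    obtain ⟨p, e1, -, e3, e4⟩ := hword j hj
    obtain rfl : p = p0 + j := by push_cast at hp0; omega
    exact ⟨e3, e4⟩
  have hlast := (hword' (k - 1) (by omega)).1
  have hτw := fun j (hj : j < k) => colour_word g ψ τ hgvw (show 1 ≤ p0 + j by omega)
    (by have := (hword' j hj).1; omega) (by omega) (hword' j hj).1 (hword' j hj).2
  by_cases hlt : g v < g w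
  · simp only [hlt, if_true] at hτw
    refine hτ p0 k hk (by omega) fun i hi => ?_
    rw [hτw i hi]
    congr 1
    omega
  · simp only [hlt, if_false] at hτw
    -- Seen from the other end, the last position `p0 + 2 * k - 1` of the square becomes its first.
    refine hτ (N + 2 - p0 - 2 * k) k hk (by omega) fun i hi => ?_
    have := hτw (k - 1 - i) (by omega)
    rw [show N + 2 - p0 - 2 * k + i = N + 1 - (p0 + (k - 1 - i) + k) by omega, ← this]
    congr 1
    omega

include hN hg1 in
/-- Follow both halves of a repetition from a time `i₀` at which they visit original vertices:
the original vertices visited, with immediate revisits omitted, form two walks `a` and `a'` in `G`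
with the same colours. -/
theorem exists_projection (t : ℕ) (u : ℕ → SubdVertex V N)
    (hadj : ∀ i, i + 1 < 2 * t → (subdivision G g N).Adj (u i) (u (i + 1)))
    (hcol : ∀ i < t, subdColouring g ψ τ (u i) = subdColouring g ψ τ (u (t + i)))
    (hne : ∀ i < t, u i ≠ u (t + i)) (i₀ : ℕ) (x₀ : V) (hx₀ : u i₀ = .inl x₀)
    (i : ℕ) (hi₀ : i₀ ≤ i) : i < t →
    ∃ (n : ℕ) (a a' : ℕ → V),
      (∀ k < n, G.Adj (a k) (a (k + 1)) ∧ G.Adj (a' k) (a' (k + 1)) ∧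
        ψ (a k) = ψ (a' k) ∧ ψ (a (k + 1)) = ψ (a' (k + 1))) ∧
      (∀ k ≤ n, g (a k) = g (a' k) ∧ a k ≠ a' k) ∧
      u (t + i₀) = .inl (a' 0) ∧
      (∀ j, i₀ ≤ j → j ≤ i → (∀ x, u j = .inl x → ∃ k ≤ n, a k = x) ∧
        (∀ x, u (t + j) = .inl x → ∃ k ≤ n, a' k = x)) ∧
      ∃ d, n * (N + 1) + d ≤ i ∧ ((d = 0 ∧ u i = .inl (a n) ∧ u (t + i) = .inl (a' n)) ∨
        ∃ w w', 1 ≤ d ∧ d ≤ N ∧ G.Adj (a n) w ∧ G.Adj (a' n) w' ∧ g w = g w' ∧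
          u i = pt g N (a n) w d ∧ u (t + i) = pt g N (a' n) w' d ∧
          ∀ l, 1 ≤ l → l ≤ d → subdColouring g ψ τ (pt g N (a n) w l)
            = subdColouring g ψ τ (pt g N (a' n) w' l)) := by
  -- Invariant: both halves are at the same distance `d` from their latest original vertices.
  -- Agreement on positions `1, …, d` is remembered so that `ψ` can be decoded at the far end, and
  -- each new vertex has cost at least `N + 1` steps.
  induction i, hi₀ using Nat.le_induction with
  | base =>
    intro hi
    obtain ⟨y₀, hy₀, hg⟩ := colour_inl_of_eq g ψ τ (hcol i₀ hi) hx₀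
    refine ⟨0, fun _ => x₀, fun _ => y₀, fun k hk => by omega, fun k _ => ⟨hg, ?_⟩, hy₀, ?_,
      0, by omega, .inl ⟨rfl, hx₀, hy₀⟩⟩
    · rintro rfl
      exact hne i₀ hi (hx₀.trans hy₀.symm)
    · intro j h1 h2
      obtain rfl : i₀ = j := by omega
      refine ⟨fun x hx => ⟨0, le_rfl, ?_⟩, fun x hx => ⟨0, le_rfl, ?_⟩⟩
      · rw [hx₀] at hx; exact Sum.inl.inj hx
      · rw [hy₀] at hx; exact Sum.inl.inj hx
  | succ i hi₀ ih =>
    intro hi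
    obtain ⟨n, a, a', h1, h2, h3, h4, d, h5, h6⟩ := ih (by omega)
    have hA := hadj i (by omega)
    have hA' := hadj (t + i) (by omega)
    have hC := hcol (i + 1) hi
    rw [← add_assoc] at hC
    -- extension of the list of visits when no new original vertex is met
    have hext : ((∃ x, u (i + 1) = .inl x) → u (i + 1) = .inl (a n)) →
        ((∃ x, u (t + i + 1) = .inl x) → u (t + i + 1) = .inl (a' n)) → ∀ j, i₀ ≤ j →
        j ≤ i + 1 → (∀ x, u j = .inl x → ∃ k ≤ n, a k = x) ∧
        (∀ x, u (t + j) = .inl x → ∃ k ≤ n, a' k = x) := by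
      intro e1 e2 j hj1 hj2
      rcases Nat.lt_or_ge i j with h | h
      · obtain rfl : j = i + 1 := by omega
        refine ⟨fun x hx => ⟨n, le_rfl, ?_⟩, fun x hx => ⟨n, le_rfl, ?_⟩⟩
        · exact Sum.inl.inj ((e1 ⟨x, hx⟩).symm.trans hx)
        · exact Sum.inl.inj ((e2 ⟨x, hx⟩).symm.trans hx)
      · exact h4 j hj1 h
    have hg := (h2 n le_rfl).1
    rcases h6 with ⟨rfl, h7, h8⟩ | ⟨w, w', hd1, hd2, hw, hw', hgw, h7, h8, h9⟩
    · rw [h7] at hA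
      rw [h8] at hA'
      obtain ⟨w, hw, hy⟩ := adj_inl hg1 hA
      obtain ⟨w', hw', hy'⟩ := adj_inl hg1 hA'
      rw [hy, hy'] at hC
      refine ⟨n, a, a', h1, h2, h3, hext ?_ ?_, 1, by omega,
        .inr ⟨w, w', le_rfl, hN, hw, hw', ?_, hy, hy', ?_⟩⟩
      · rintro ⟨x, hx⟩
        exact absurd (hy.symm.trans hx) (pt_ne_inl g le_rfl hN)
      · rintro ⟨x, hx⟩
        exact absurd (hy'.symm.trans hx) (pt_ne_inl g le_rfl hN)
      · exact colour_first g ψ τ (hg1 _ _ hw) (hg1 _ _ hw') hg le_rfl hN le_rfl hN hC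
      · intro l hl1 hl2
        obtain rfl : l = 1 := by omega
        exact hC
    · rw [h7] at hA
      rw [h8] at hA'
      have hgn := hg1 _ _ hw
      -- Opposite moves would give positions two apart, with different residues modulo 3.
      have hboth : (u (i + 1) = pt g N (a n) w (d - 1) ∧
          u (t + i + 1) = pt g N (a' n) w' (d - 1)) ∨
          (u (i + 1) = pt g N (a n) w (d + 1) ∧ u (t + i + 1) = pt g N (a' n) w' (d + 1)) := by
        rcases adj_inner hg1 hw hd1 hd2 hA with hy | hy <;>
          rcases adj_inner hg1 hw' hd1 hd2 hA' with hy' | hy'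
        · exact .inl ⟨hy, hy'⟩
        · rw [hy, hy'] at hC
          have := mod_three_of_colour g ψ τ hgn hg hgw (by omega) (by omega) hC
          omega
        · rw [hy, hy'] at hC
          have := mod_three_of_colour g ψ τ hgn hg hgw (by omega) (by omega) hC
          omega
        · exact .inr ⟨hy, hy'⟩
      rcases hboth with ⟨hy, hy'⟩ | ⟨hy, hy'⟩
      · rcases Nat.lt_or_ge 1 d with hd | hd
        · refine ⟨n, a, a', h1, h2, h3, hext ?_ ?_, d - 1, by omega,
            .inr ⟨w, w', by omega, by omega, hw, hw', hgw, hy, hy',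
              fun l hl1 hl2 => h9 l hl1 (by omega)⟩⟩
          · rintro ⟨x, hx⟩
            exact absurd (hy.symm.trans hx) (pt_ne_inl g (by omega) (by omega))
          · rintro ⟨x, hx⟩
            exact absurd (hy'.symm.trans hx) (pt_ne_inl g (by omega) (by omega))
        -- Backtracking to `a n` and `a' n` records no new visit.
        · obtain rfl : d = 1 := by omega
          rw [show 1 - 1 = 0 from rfl, pt_zero] at hy hy'
          exact ⟨n, a, a', h1, h2, h3, hext (fun _ => hy) (fun _ => hy'), 0,
            by omega, .inl ⟨rfl, hy, hy'⟩⟩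
      · rcases Nat.lt_or_ge d N with hd | hd
        · refine ⟨n, a, a', h1, h2, h3, hext ?_ ?_, d + 1, by omega,
            .inr ⟨w, w', by omega, by omega, hw, hw', hgw, hy, hy', fun l hl1 hl2 => ?_⟩⟩
          · rintro ⟨x, hx⟩
            exact absurd (hy.symm.trans hx) (pt_ne_inl g (by omega) (by omega))
          · rintro ⟨x, hx⟩
            exact absurd (hy'.symm.trans hx) (pt_ne_inl g (by omega) (by omega))
          · rcases Nat.lt_or_ge d l with hl | hl
            · obtain rfl : l = d + 1 := by omega
              rwa [hy, hy'] at hC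
            · exact h9 l hl1 hl
        · obtain rfl : d = N := by omega
          rw [pt_last] at hy hy'
          -- The whole edge has now been seen with equal colours.
          have hψ := colour_bits g ψ τ hgn hg hgw h9
          refine ⟨n + 1, Function.update a (n + 1) w, Function.update a' (n + 1) w', ?_, ?_, ?_, ?_,
            0, ?_, .inl ⟨rfl, ?_, ?_⟩⟩
          · intro k hk
            rcases Nat.lt_or_ge k n with hkn | hkn
            · simp only [Function.update_of_ne (show k ≠ n + 1 by omega),
                Function.update_of_ne (show k + 1 ≠ n + 1 by omega)]
              exact h1 k hkn
            · obtain rfl : k = n := by omega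
              simp only [Function.update_of_ne (show k ≠ k + 1 by omega), Function.update_self]
              exact ⟨hw, hw', hψ⟩
          · intro k hk
            rcases Nat.lt_or_ge n k with hkn | hkn
            · obtain rfl : k = n + 1 := by omega
              simp only [Function.update_self]
              refine ⟨hgw, fun h => hne (i + 1) hi ?_⟩
              rw [← add_assoc, hy, hy', h]
            · simp only [Function.update_of_ne (show k ≠ n + 1 by omega)]
              exact h2 k hkn
          · rwa [Function.update_of_ne (by omega)]
          · intro j hj1 hj2
            rcases Nat.lt_or_ge i j with h | h
            · obtain rfl : j = i + 1 := by omega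
              refine ⟨fun x hx => ⟨n + 1, le_rfl, ?_⟩, fun x hx => ⟨n + 1, le_rfl, ?_⟩⟩
              · rw [Function.update_self]; exact Sum.inl.inj (hy.symm.trans hx)
              · rw [Function.update_self]; exact Sum.inl.inj (hy'.symm.trans hx)
            · refine ⟨fun x hx => ?_, fun x hx => ?_⟩
              · obtain ⟨k, hk, e⟩ := (h4 j hj1 h).1 x hx
                exact ⟨k, by omega, by rwa [Function.update_of_ne (by omega)]⟩
              · obtain ⟨k, hk, e⟩ := (h4 j hj1 h).2 x hx
                exact ⟨k, by omega, by rwa [Function.update_of_ne (by omega)]⟩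
          · rw [Nat.succ_mul]; omega
          · rwa [Function.update_self]
          · rwa [Function.update_self]

include hg1 in
/-- If all original vertices visited by a walk in the subdivided graph lie in `K`, and `K` is
visited, then the order of the walk is at most `|K| * D * (N + 2)`. -/
theorem order_le [DecidableEq V] {D : ℕ} (hN : 0 < N) (nb : V → Fin D → V)
    (hnb : ∀ v w, G.Adj v w → ∃ k, nb v k = w) (n : ℕ) (u : ℕ → SubdVertex V N) (hn : 2 ≤ n)
    (hadj : ∀ i, i + 1 < n → (subdivision G g N).Adj (u i) (u (i + 1)))
    (K : Finset V) (hK : ∀ i < n, ∀ x, u i = .inl x → x ∈ K) (i₀ : ℕ) (hi₀ : i₀ < n) (x₀ : V)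
    (hx₀ : u i₀ = .inl x₀) :
    ((Finset.range n).image u).card ≤ K.card * (D * (N + 2)) := by
  -- The walk changes edges only through original vertices, which lie in `K`, so `P` spreads from `u
  -- i₀` in both directions of time.
  let P : SubdVertex V N → Prop :=
    fun y => ∃ v ∈ K, ∃ w, G.Adj v w ∧ ∃ d ≤ N + 1, y = pt g N v w d
  have hstep : ∀ x y, (subdivision G g N).Adj x y → (∀ z, x = .inl z → z ∈ K) → P x → P y := by
    rintro x y hxy hx ⟨v, hv, w, hvw, d, hd, rfl⟩
    rcases Nat.eq_zero_or_pos d with rfl | h1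
    · rw [pt_zero] at hxy
      obtain ⟨w', hw', rfl⟩ := adj_inl hg1 hxy
      exact ⟨v, hv, w', hw', 1, by omega, rfl⟩
    rcases Nat.lt_or_ge N d with h2 | h2
    · obtain rfl : d = N + 1 := by omega
      rw [pt_last] at hxy
      obtain ⟨w', hw', rfl⟩ := adj_inl hg1 hxy
      exact ⟨w, hx w (pt_last g v w), w', hw', 1, by omega, rfl⟩
    · rcases adj_inner hg1 hvw h1 h2 hxy with rfl | rfl
      · exact ⟨v, hv, w, hvw, d - 1, by omega, rfl⟩
      · exact ⟨v, hv, w, hvw, d + 1, by omega, rfl⟩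
  have hP0 : P (u i₀) := by
    have hx₀K := hK i₀ hi₀ x₀ hx₀
    have : ∃ y, (subdivision G g N).Adj (u i₀) y := by
      rcases Nat.lt_or_ge (i₀ + 1) n with h | h
      · exact ⟨_, hadj i₀ h⟩
      · have := hadj (i₀ - 1) (by omega)
        rw [show i₀ - 1 + 1 = i₀ by omega] at this
        exact ⟨_, this.symm⟩
    obtain ⟨y, hy⟩ := this
    rw [hx₀] at hy ⊢
    obtain ⟨w, hw, -⟩ := adj_inl hg1 hy
    exact ⟨x₀, hx₀K, w, hw, 0, by omega, (pt_zero g x₀ w).symm⟩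
  have hfwd : ∀ j, i₀ ≤ j → j < n → P (u j) := by
    intro j hj
    induction j, hj using Nat.le_induction with
    | base => exact fun _ => hP0
    | succ j hj ih => exact fun h => hstep _ _ (hadj j h) (hK j (by omega)) (ih (by omega))
  have hbwd : ∀ k ≤ i₀, P (u (i₀ - k)) := by
    intro k
    induction k with
    | zero => exact fun _ => hP0
    | succ k ih =>
      intro hk
      have := hadj (i₀ - (k + 1)) (by omega)
      rw [show i₀ - (k + 1) + 1 = i₀ - k by omega] at this
      exact hstep _ _ this.symm (hK _ (by omega)) (ih (by omega))
  have hsub : (Finset.range n).image u ⊆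
      (K ×ˢ ((Finset.univ : Finset (Fin D)) ×ˢ Finset.range (N + 2))).image
        (fun q => pt g N q.1 (nb q.1 q.2.1) q.2.2) := by
    intro y hy
    simp only [Finset.mem_image, Finset.mem_range] at hy
    obtain ⟨j, hj, rfl⟩ := hy
    have hP : P (u j) := by
      rcases Nat.le_total i₀ j with h | h
      · exact hfwd j h hj
      · have := hbwd (i₀ - j) (by omega)
        rwa [show i₀ - (i₀ - j) = j by omega] at this
    obtain ⟨v, hv, w, hvw, d, hd, he⟩ := hP
    obtain ⟨k, rfl⟩ := hnb v w hvw
    rw [Finset.mem_image]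
    refine ⟨(v, k, d), ?_, he.symm⟩
    simp only [Finset.mem_product, Finset.mem_univ, Finset.mem_range, true_and]
    exact ⟨hv, by omega⟩
  refine (Finset.card_le_card hsub).trans (Finset.card_image_le.trans ?_)
  simp [Finset.card_product]

include hN hg1 in
/-- A short repetition in the subdivided graph with different halves yields a short repetition
in `G`. -/
theorem exists_repetition_of_subdivision [DecidableEq V] {D : ℕ} (nb : V → Fin D → V)
    (hnb : ∀ v w, G.Adj v w → ∃ k, nb v k = w)
    (hτ : ∀ a k : ℕ, 1 ≤ k → a + 2 * k ≤ N + 1 → ¬ ∀ i < k, τ (a + i) = τ (a + k + i))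
    (t h : ℕ) (u : ℕ → SubdVertex V N) (ht : 1 ≤ t)
    (hadj : ∀ i, i + 1 < 2 * t → (subdivision G g N).Adj (u i) (u (i + 1)))
    (hcol : ∀ i < t, subdColouring g ψ τ (u i) = subdColouring g ψ τ (u (t + i)))
    (hne : ∀ i < t, u i ≠ u (t + i))
    (hlen : 2 * t ≤ h * ((Finset.range (2 * t)).image u).card) :
    ∃ (s : ℕ) (w : ℕ → V), 1 ≤ s ∧ (∀ i, i + 1 < 2 * s → G.Adj (w i) (w (i + 1))) ∧
      (∀ i < s, w i ≠ w (s + i)) ∧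
      2 * s ≤ (2 + 4 * h * D) * ((Finset.range (2 * s)).image w).card ∧
      (∀ i < s, g (w i) = g (w (s + i))) ∧ (∀ i < s, ψ (w i) = ψ (w (s + i))) := by
  classical
  have htt : t - 1 + 1 = t + 0 := by omega
  have hcore := exists_original_of_repetition ψ τ hg1 hτ t u ht hadj hcol hne
  -- Starting at the first visit to an original vertex ensures that neither half visits one before
  -- its own time `i₀`.
  let i₀ := Nat.find hcore
  obtain ⟨hi₀, x₀, hx₀⟩ : i₀ < t ∧ ∃ x, u i₀ = .inl x := Nat.find_spec hcore
  have hmin : ∀ i < i₀, ∀ x, u i ≠ .inl x := fun i hi x hx =>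
    Nat.find_min hcore hi ⟨by omega, x, hx⟩
  have hmin' : ∀ i < i₀, ∀ x, u (t + i) ≠ .inl x := by
    intro i hi x hx
    obtain ⟨y, hy, -⟩ := colour_inl_of_eq g ψ τ (hcol i (by omega)).symm hx
    exact hmin i hi y hy
  obtain ⟨n, a, a', h1, h2, h3, h4, d, h5, h6⟩ := exists_projection ψ τ hN hg1 t u hadj hcol hne
    i₀ x₀ hx₀ (t - 1) (by omega) (by omega)
  -- from the last original vertex of the first half to the first one of the second half
  have hlink : ∀ i ≤ i₀, ∃ w, G.Adj (a n) w ∧ ∃ e ≤ N + 1, u (t + i) = pt g N (a n) w e := by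
    intro i
    induction i with
    | zero =>
      intro _
      have hA := hadj (t - 1) (by omega)
      rw [htt] at hA
      rcases h6 with ⟨-, h7, -⟩ | ⟨w, -, hd1, hd2, hw, -, -, h7, -⟩
      · rw [h7] at hA
        obtain ⟨w, hw, he⟩ := adj_inl hg1 hA
        exact ⟨w, hw, 1, by omega, he⟩
      · rw [h7] at hA
        rcases adj_inner hg1 hw hd1 hd2 hA with he | he
        · exact ⟨w, hw, d - 1, by omega, he⟩
        · exact ⟨w, hw, d + 1, by omega, he⟩
    | succ i ih =>
      intro hi
      obtain ⟨w, hw, e, he, hu⟩ := ih (by omega)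
      have hnc := hmin' i (by omega)
      have e1 : 1 ≤ e := by
        by_contra hc
        obtain rfl : e = 0 := by omega
        exact hnc _ (hu.trans (pt_zero g _ _))
      have e2 : e ≤ N := by
        by_contra hc
        obtain rfl : e = N + 1 := by omega
        exact hnc _ (hu.trans (pt_last g _ _))
      have hA := hadj (t + i) (by omega)
      rw [hu] at hA
      rcases adj_inner hg1 hw e1 e2 hA with he | he
      · exact ⟨w, hw, e - 1, by omega, he⟩
      · exact ⟨w, hw, e + 1, by omega, he⟩
  have hjoin : a' 0 = a n ∨ G.Adj (a n) (a' 0) := by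
    obtain ⟨w, hw, e, he, hu⟩ := hlink i₀ le_rfl
    rw [h3] at hu
    rcases pt_eq_inl g he hu.symm with ⟨-, h⟩ | ⟨-, h⟩
    · exact .inl h.symm
    · exact .inr (h ▸ hw)
  -- Otherwise the distinct vertices `a 0` and `a' 0`, of equal colour under `g`, would be adjacent.
  have hn : 1 ≤ n := by
    by_contra hc
    obtain rfl : n = 0 := by omega
    have hg := h2 0 le_rfl
    rcases hjoin with h | h
    · exact hg.2 h.symm
    · exact hg1 _ _ h hg.1
  have hψ : ∀ k ≤ n, ψ (a k) = ψ (a' k) := by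
    intro k hk
    rcases Nat.lt_or_ge k n with h | h
    · exact (h1 k h).2.2.1
    · have := (h1 (k - 1) (by omega)).2.2.2
      rwa [show k - 1 + 1 = k by omega] at this
  let K : Finset V := (Finset.range (n + 1)).image a ∪ (Finset.range (n + 1)).image a'
  have hmemK : ∀ x, (∃ k ≤ n, a k = x) ∨ (∃ k ≤ n, a' k = x) → x ∈ K := by
    intro x hx
    simp only [K, Finset.mem_union, Finset.mem_image, Finset.mem_range, Nat.lt_succ_iff]
    exact hx
  have hK : ∀ i < 2 * t, ∀ x, u i = .inl x → x ∈ K := by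
    intro i hi x hx
    rcases Nat.lt_or_ge i t with hit | hit
    · have : i₀ ≤ i := by
        by_contra hc
        exact hmin i (by omega) x hx
      exact hmemK x (.inl ((h4 i this (by omega)).1 x hx))
    · obtain ⟨j, rfl⟩ : ∃ j, i = t + j := ⟨i - t, by omega⟩
      have : i₀ ≤ j := by
        by_contra hc
        exact hmin' j (by omega) x hx
      exact hmemK x (.inr ((h4 j this (by omega)).2 x hx))
  have hord := order_le hg1 hN nb hnb (2 * t) u (by omega) hadj K hK i₀ (by omega) x₀ hx₀
  -- From `2n(N + 1) ≤ h * order` and `N + 2 ≤ 2(N + 1)`, the factor `N + 1` cancels: the bound does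
  -- not depend on `N`.
  have hnK : n ≤ 2 * (h * D) * K.card - n := by
    have e1 : 2 * (n * (N + 1)) ≤ h * (K.card * (D * (N + 2))) := by
      have := Nat.mul_le_mul_left h hord
      omega
    have e2 : h * (K.card * (D * (N + 2))) ≤ h * (K.card * (D * (2 * (N + 1)))) := by
      gcongr
      omega
    have e3 : (2 * n) * (N + 1) ≤ (2 * (h * D) * K.card) * (N + 1) := by
      calc (2 * n) * (N + 1) = 2 * (n * (N + 1)) := by ring
        _ ≤ h * (K.card * (D * (2 * (N + 1)))) := e1.trans e2
        _ = _ := by ring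
    have := Nat.le_of_mul_le_mul_right e3 (by omega)
    omega
  have hbound : ∀ o : ℕ, 1 ≤ o → K.card ≤ 2 * o → 2 * (n + 1) ≤ (2 + 4 * h * D) * o := by
    intro o ho hKo
    have e1 : 2 * (h * D) * K.card ≤ 2 * (h * D) * (2 * o) := Nat.mul_le_mul_left _ hKo
    have e2 : (2 + 4 * h * D) * o = 2 * o + 2 * (h * D) * (2 * o) := by ring
    omega
  rcases hjoin with hj | hj
  -- The shared vertex `a n = a' 0` is used once, and `a' n` is dropped to keep equal halves. Thus
  -- `K` has at most one vertex outside the walk, and `|K|` is at most twice its order.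
  · let w : ℕ → V := fun i => if i < n then a i else a' (i - n)
    have hw1 : ∀ i < n, w i = a i := fun i hi => if_pos hi
    have hw2 : ∀ i, w (n + i) = a' i := fun i => by
      simp only [w]
      rw [if_neg (by omega), Nat.add_sub_cancel_left]
    refine ⟨n, w, hn, ?_, ?_, ?_, ?_, ?_⟩
    · intro i hi
      rcases Nat.lt_trichotomy (i + 1) n with h | h | h
      · rw [hw1 i (by omega), hw1 (i + 1) h]
        exact (h1 i (by omega)).1
      · have := (h1 i (by omega)).1
        rw [hw1 i (by omega), show i + 1 = n + 0 by omega, hw2, hj, ← h]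
        exact this
      · obtain ⟨j, rfl⟩ : ∃ j, i = n + j := ⟨i - n, by omega⟩
        rw [hw2, add_assoc, hw2]
        exact (h1 j (by omega)).2.1
    · intro i hi
      rw [hw1 i hi, hw2]
      exact (h2 i hi.le).2
    · have hKw : K ⊆ insert (a' n) ((Finset.range (2 * n)).image w) := by
        intro x hx
        simp only [K, Finset.mem_union, Finset.mem_image, Finset.mem_range, Nat.lt_succ_iff] at hx
        simp only [Finset.mem_insert, Finset.mem_image, Finset.mem_range]
        rcases hx with ⟨k, hk, rfl⟩ | ⟨k, hk, rfl⟩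
        · rcases Nat.lt_or_ge k n with h | h
          · exact .inr ⟨k, by omega, hw1 k h⟩
          · obtain rfl : k = n := by omega
            exact .inr ⟨k, by omega, by rw [← hj]; exact hw2 0⟩
        · rcases Nat.lt_or_ge k n with h | h
          · exact .inr ⟨n + k, by omega, hw2 k⟩
          · obtain rfl : k = n := by omega
            exact .inl rfl
      have hpos : 0 < ((Finset.range (2 * n)).image w).card := by
        rw [Finset.card_pos]
        exact ⟨w 0, Finset.mem_image_of_mem _ (by simp; omega)⟩
      have e1 := (Finset.card_le_card hKw).trans (Finset.card_insert_le _ _)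
      have := hbound _ hpos (by omega)
      omega
    · intro i hi
      rw [hw1 i hi, hw2]
      exact (h2 i hi.le).1
    · intro i hi
      rw [hw1 i hi, hw2]
      exact hψ i hi.le
  · let w : ℕ → V := fun i => if i < n + 1 then a i else a' (i - (n + 1))
    have hw1 : ∀ i < n + 1, w i = a i := fun i hi => if_pos hi
    have hw2 : ∀ i, w (n + 1 + i) = a' i := fun i => by
      simp only [w]
      rw [if_neg (by omega), Nat.add_sub_cancel_left]
    refine ⟨n + 1, w, by omega, ?_, ?_, ?_, ?_, ?_⟩
    · intro i hi
      rcases Nat.lt_trichotomy i n with h | h | h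
      · rw [hw1 i (by omega), hw1 (i + 1) (by omega)]
        exact (h1 i (by omega)).1
      · subst h
        rw [hw1 i (by omega), show i + 1 = i + 1 + 0 by omega, hw2]
        exact hj
      · obtain ⟨j, rfl⟩ : ∃ j, i = n + 1 + j := ⟨i - (n + 1), by omega⟩
        rw [hw2, add_assoc (n + 1), hw2]
        exact (h1 j (by omega)).2.1
    · intro i hi
      rw [hw1 i hi, hw2]
      exact (h2 i (by omega)).2
    · have hKw : K ⊆ (Finset.range (2 * (n + 1))).image w := by
        intro x hx
        simp only [K, Finset.mem_union, Finset.mem_image, Finset.mem_range] at hx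
        simp only [Finset.mem_image, Finset.mem_range]
        rcases hx with ⟨k, hk, rfl⟩ | ⟨k, hk, rfl⟩
        · exact ⟨k, by omega, hw1 k hk⟩
        · exact ⟨n + 1 + k, by omega, hw2 k⟩
      have hpos : 0 < ((Finset.range (2 * (n + 1))).image w).card := by
        rw [Finset.card_pos]
        exact ⟨w 0, Finset.mem_image_of_mem _ (by simp)⟩
      have e1 := Finset.card_le_card hKw
      exact hbound _ hpos (by omega)
    · intro i hi
      rw [hw1 i hi, hw2]
      exact (h2 i (by omega)).1
    · intro i hi
      rw [hw1 i hi, hw2]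
      exact hψ i (by omega)

end Extraction

/-! ### Walks as sequences, and distance-2 colourings -/

/-- A sequence of consecutively adjacent vertices is the vertex sequence of a walk. -/
theorem exists_walk_of_sequence {V : Type*} {G : SimpleGraph V} (n : ℕ) (w : ℕ → V)
    (h : ∀ i < n, G.Adj (w i) (w (i + 1))) :
    ∃ p : G.Walk (w 0) (w n), p.length = n ∧ ∀ i ≤ n, p.getVert i = w i := by
  induction n generalizing w with
  | zero => exact ⟨.nil, rfl, fun i hi => by obtain rfl : i = 0 := by omega
                                             rfl⟩
  | succ n ih =>
    obtain ⟨p, hp, hg⟩ := ih (fun i => w (i + 1)) (fun i hi => h (i + 1) (by omega))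
    refine ⟨.cons (h 0 (by omega)) p, by simp [hp], fun i hi => ?_⟩
    rcases i with _ | i
    · rfl
    · rw [SimpleGraph.Walk.getVert_cons_succ]
      exact hg i (by omega)

theorem walkLength_eq {V : Type*} {G : SimpleGraph V} {u v : V} (p : G.Walk u v) :
    walkLength p = p.length + 1 := by
  simp [walkLength]

theorem walkOrder_eq {V : Type*} [DecidableEq V] {G : SimpleGraph V} {u v : V} (p : G.Walk u v) :
    walkOrder p = ((Finset.range (walkLength p)).image p.getVert).card := by
  rw [walkOrder, walkLength_eq, ← Set.ncard_coe_finset]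
  congr 1
  ext x
  simp only [Set.mem_ofPred_eq, Finset.coe_image, Finset.coe_range, Set.mem_image, Set.mem_Iio,
    SimpleGraph.Walk.mem_support_iff_exists_getVert, Nat.lt_succ_iff]
  exact ⟨fun ⟨n, h1, h2⟩ => ⟨n, h2, h1⟩, fun ⟨n, h1, h2⟩ => ⟨n, h2, h1⟩⟩

theorem adj_getVert_of_walkLength {V : Type*} {G : SimpleGraph V} {u v : V} (p : G.Walk u v)
    {n : ℕ} (hn : walkLength p = n) (i : ℕ) (hi : i + 1 < n) :
    G.Adj (p.getVert i) (p.getVert (i + 1)) := by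
  rw [walkLength_eq] at hn
  exact p.adj_getVert_succ (by omega)

/-- If a repetition under a colouring that is injective on neighbourhoods has a common position
of its two halves, then the two halves coincide. -/
theorem halves_eq_of_eq {V C : Type*} {G : SimpleGraph V} (f : V → C)
    (hf : ∀ x y z, G.Adj x y → G.Adj x z → f y = f z → y = z) (t : ℕ) (u : ℕ → V)
    (hadj : ∀ i, i + 1 < 2 * t → G.Adj (u i) (u (i + 1)))
    (hcol : ∀ i < t, f (u i) = f (u (t + i))) (i : ℕ) (hi : i < t) (heq : u i = u (t + i)) :
    ∀ j < t, u j = u (t + j) := by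
  have hfwd : ∀ j, i ≤ j → j < t → u j = u (t + j) := by
    intro j hj
    induction j, hj using Nat.le_induction with
    | base => exact fun _ => heq
    | succ j hj ih =>
      intro hjt
      have h := ih (by omega)
      refine hf (u j) _ _ (hadj j (by omega)) ?_ (hcol _ hjt)
      rw [h]
      exact hadj (t + j) (by omega)
  have hbwd : ∀ k ≤ i, u (i - k) = u (t + (i - k)) := by
    intro k
    induction k with
    | zero => exact fun _ => heq
    | succ k ih =>
      intro hk
      have h := ih (by omega)
      have e1 := hadj (i - (k + 1)) (by omega)
      have e2 := hadj (t + (i - (k + 1))) (by omega)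
      rw [show i - (k + 1) + 1 = i - k by omega] at e1
      rw [show t + (i - (k + 1)) + 1 = t + (i - k) by omega, ← h] at e2
      exact hf _ _ _ e1.symm e2.symm (hcol _ (by omega))
  intro j hj
  rcases Nat.le_total i j with h | h
  · exact hfwd j h hj
  · have := hbwd (i - j) (by omega)
    rwa [show i - (i - j) = j by omega] at this

/-- A colouring that is proper and injective on neighbourhoods is a distance-2 colouring. -/
theorem isDistanceTwoColouring_of_local {V C : Type*} {G : SimpleGraph V} (f : V → C)
    (h1 : ∀ x y, G.Adj x y → f x ≠ f y)
    (h2 : ∀ x y z, G.Adj x y → G.Adj x z → f y = f z → y = z) : IsDistanceTwoColouring G f := by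
  rintro v w ⟨hne, hd⟩ heq
  have htop : G.edist v w ≠ ⊤ := fun h => by
    rw [h] at hd
    exact absurd hd (by decide)
  obtain ⟨p, hp⟩ := SimpleGraph.exists_walk_of_edist_ne_top htop
  rw [← hp] at hd
  have hlen : p.length ≤ 2 := by exact_mod_cast hd
  rcases p with _ | ⟨ha, q⟩
  · exact hne rfl
  · rcases q with _ | ⟨hb, q'⟩
    · exact h1 _ _ ha heq
    · rcases q' with _ | ⟨hc, q''⟩
      · exact hne (h2 _ _ _ ha.symm hb heq)
      · simp only [SimpleGraph.Walk.length_cons] at hlen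
        omega

/-! ### Lifting repetitions to the subdivided graph -/

section Lift

variable {V : Type} {c N b : ℕ} {G : SimpleGraph V} {g : V → Fin c} (ψ : V → Fin N)
  (τ : ℕ → Fin b) (hg1 : ∀ v w, G.Adj v w → g v ≠ g w)

include hg1 in
/-- A non-boring repetition `w 0, …, w (2t-1)` in `G`, extended by an edge to a vertex `w (2t)`
that has the colour of `w t`, gives a repetitively coloured non-boring walk in the subdivided
graph. -/
theorem exists_lift (t : ℕ) (w : ℕ → V) (ht : 1 ≤ t)
    (hadj : ∀ i, i < 2 * t → G.Adj (w i) (w (i + 1)))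
    (hg : ∀ i ≤ t, g (w i) = g (w (t + i))) (hψ : ∀ i ≤ t, ψ (w i) = ψ (w (t + i)))
    (hne : ∃ i < t, w i ≠ w (t + i)) :
    ∃ (x y : SubdVertex V N) (p : (subdivision G g N).Walk x y),
      IsRepetitive (subdColouring g ψ τ) p ∧ ¬ IsBoring p := by
  -- Each of the `2 * t` edges contributes its first `N + 1` vertices. The extra edge completes the
  -- second half, and its end `w (2 * t)` is itself left out.
  let u : ℕ → SubdVertex V N :=
    fun i => pt g N (w (i / (N + 1))) (w (i / (N + 1) + 1)) (i % (N + 1))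
  have hpos : 1 ≤ t * (N + 1) := Nat.one_le_iff_ne_zero.2 (by positivity)
  have hu : ∀ i, i + 1 < 2 * (t * (N + 1)) → (subdivision G g N).Adj (u i) (u (i + 1)) := by
    intro i hi
    have hq : i / (N + 1) < 2 * t := by
      rw [Nat.div_lt_iff_lt_mul (by omega), mul_assoc]
      omega
    have hr := Nat.mod_lt i (show 0 < N + 1 by omega)
    have hA := adj_pt hg1 (hadj _ hq) (show i % (N + 1) ≤ N by omega)
    have hnext : u (i + 1) = pt g N (w (i / (N + 1))) (w (i / (N + 1) + 1)) (i % (N + 1) + 1) := by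
      have hdm := Nat.div_add_mod' i (N + 1)
      rcases Nat.lt_or_ge (i % (N + 1)) N with h | h
      · have e1 : (i + 1) / (N + 1) = i / (N + 1) := by
          rw [Nat.div_eq_iff (by omega)]
          constructor <;> omega
        have e2 : (i + 1) % (N + 1) = i % (N + 1) + 1 := by
          rw [Nat.add_mod, Nat.mod_eq_of_lt (show 1 < N + 1 by omega)]
          exact Nat.mod_eq_of_lt (by omega)
        simp only [u, e1, e2]
      · have hN : i % (N + 1) = N := by omega
        have e0 : i + 1 = (N + 1) * (i / (N + 1) + 1) := by
          rw [mul_add, mul_comm]; omega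
        have e1 : (i + 1) / (N + 1) = i / (N + 1) + 1 := by
          rw [e0]
          exact Nat.mul_div_cancel_left _ (by omega)
        have e2 : (i + 1) % (N + 1) = 0 := by
          rw [e0]
          exact Nat.mul_mod_right _ _
        simp only [u, e1, e2, hN, pt_last, pt_zero]
    rw [hnext]
    exact hA
  have hshift : ∀ i, u (t * (N + 1) + i)
      = pt g N (w (t + i / (N + 1))) (w (t + i / (N + 1) + 1)) (i % (N + 1)) := by
    intro i
    have e1 : (t * (N + 1) + i) / (N + 1) = t + i / (N + 1) := by
      rw [mul_comm, Nat.mul_add_div (by omega)]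
    have e2 : (t * (N + 1) + i) % (N + 1) = i % (N + 1) := by
      rw [mul_comm, Nat.mul_add_mod]
    simp only [u, e1, e2]
  obtain ⟨p, hp, hpu⟩ := exists_walk_of_sequence (2 * (t * (N + 1)) - 1) u
    (fun i hi => hu i (by omega))
  have hlen : walkLength p = 2 * (t * (N + 1)) := by rw [walkLength_eq]; omega
  refine ⟨_, _, p, ⟨t * (N + 1), hlen, fun i hi => ?_⟩, ?_⟩
  · rw [hpu i (by omega), hpu _ (by omega), hshift]
    have hq : i / (N + 1) < t := by
      rwa [Nat.div_lt_iff_lt_mul (by omega)]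
    exact colour_pt_congr g ψ τ _ (hg _ hq.le) (hg _ hq) (hψ _ hq.le) (hψ _ hq)
  · rintro ⟨t', ht', hb⟩
    obtain rfl : t' = t * (N + 1) := by omega
    obtain ⟨i, hi, hwi⟩ := hne
    have hi' : i * (N + 1) < t * (N + 1) := Nat.mul_lt_mul_of_pos_right hi (by omega)
    have := hb (i * (N + 1)) hi'
    rw [hpu _ (by omega), hpu _ (by omega), hshift] at this
    simp only [u, Nat.mul_div_cancel _ (show 0 < N + 1 by omega), Nat.mul_mod_left, pt_zero,
      Sum.inl.injEq] at this
    exact hwi this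

end Lift

/-! ### Choice of the constants and the final colouring -/

/-- If the conjecture on small walks holds, then graphs of bounded degree have walk-nonrepetitive
colourings with a bounded number of colours. The conjecture is applied to the graph in which each
edge is subdivided `N` times, whose number of colours does not depend on `N`. -/
theorem exists_colouring_of_smallWalks (hconj : SmallWalksConjecture) (D : ℕ) (hD : 0 < D) :
    ∃ k : ℕ, ∀ (V : Type) [Fintype V] (G : SimpleGraph V) (nb : V → Fin D → V),
      (∀ v w, G.Adj v w → ∃ i, nb v i = w) → ∃ φ : V → Fin k, IsWalkNonrepetitive G φ := by
  classical
  obtain ⟨h, hh⟩ := hconj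
  obtain ⟨b, hb, hτ⟩ := exists_squarefree_word
  -- Paths have length equal to order, hence the factor 1 in place of `h`.
  obtain ⟨N₀, hN₀, h₀⟩ := exists_no_short_repetition D (2 + 4 * 1 * D) hD
  let c := N₀ * (Fintype.card (Fin D ⊕ Fin D × Fin D) + 1)
  let c' := Fintype.card (SubdColour c b)
  -- Only now is `N` chosen: `c'` depends on `D` and `b` alone, as `N₀` does on `D`.
  obtain ⟨N, hN, h₁⟩ := exists_no_short_repetition D (2 + 4 * h c' * D) hD
  refine ⟨Fintype.card (Fin c × Fin N × Finset (Fin c × Fin N)), ?_⟩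
  intro V _ G nb hnb
  obtain ⟨g₁, hg₁⟩ := h₀ V G.Adj nb hnb (fun _ _ => SimpleGraph.Adj.symm)
  obtain ⟨g₂, hg₂⟩ := exists_proper (Fin D ⊕ Fin D × Fin D) V
    (fun v w => v ≠ w ∧ (G.Adj v w ∨ ∃ u, G.Adj u v ∧ G.Adj u w))
    (fun v k => Sum.elim (nb v) (fun q => nb (nb v q.1) q.2) k) (by
      rintro v w ⟨-, hvw | ⟨u, huv, huw⟩⟩
      · obtain ⟨i, hi⟩ := hnb v w hvw
        exact ⟨.inl i, hi⟩
      · obtain ⟨i, rfl⟩ := hnb v u huv.symm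
        obtain ⟨j, rfl⟩ := hnb _ w huw
        exact ⟨.inr (i, j), rfl⟩)
    (by
      rintro v w ⟨hne, hvw | ⟨u, huv, huw⟩⟩
      · exact ⟨hne.symm, .inl hvw.symm⟩
      · exact ⟨hne.symm, .inr ⟨u, huw, huv⟩⟩)
    (fun v hv => hv.1 rfl)
  obtain ⟨ψ, hψ⟩ := h₁ V G.Adj nb hnb (fun _ _ => SimpleGraph.Adj.symm)
  obtain ⟨τ, hτ⟩ := hτ (N + 1)
  let g : V → Fin c := fun v => finProdFinEquiv (g₁ v, g₂ v)
  have hg : ∀ v w, g v = g w → g₁ v = g₁ w ∧ g₂ v = g₂ w := by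
    intro v w hvw
    simpa [g] using hvw
  have hgadj : ∀ v w, G.Adj v w → g v ≠ g w := fun v w hvw heq =>
    hg₂ v w ⟨hvw.ne, .inl hvw⟩ (hg v w heq).2
  have hgcommon : ∀ u v w, G.Adj u v → G.Adj u w → v ≠ w → g v ≠ g w :=
    fun u v w huv huw hvw heq => hg₂ v w ⟨hvw, .inr ⟨u, huv, huw⟩⟩ (hg v w heq).2
  let e := Fintype.equivFin (SubdColour c b)
  let f : SubdVertex V N → Fin c' := fun x => e (subdColouring g ψ τ x)
  have hfe : ∀ x y, f x = f y ↔ subdColouring g ψ τ x = subdColouring g ψ τ y :=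
    fun x y => e.apply_eq_iff_eq
  have hfadj : ∀ x y, (subdivision G g N).Adj x y → f x ≠ f y := fun x y hxy heq =>
    subdColouring_adj_ne ψ τ hgadj hxy ((hfe x y).1 heq)
  have hfcommon : ∀ x y z, (subdivision G g N).Adj x y → (subdivision G g N).Adj x z →
      f y = f z → y = z := fun x y z hxy hxz heq =>
    subdColouring_common_ne ψ τ hgadj hN hgcommon hxy hxz ((hfe y z).1 heq)
  have hpath : IsPathNonrepetitive (subdivision G g N) f := by
    rintro x y p hp ⟨t, ht, hcol⟩
    have hpl := walkLength_eq p
    have hinj := hp.getVert_injOn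
    obtain ⟨s, w, hs1, hs2, hs3, hs4, hs5, -⟩ := exists_repetition_of_subdivision ψ τ hN hgadj nb
      hnb hτ t 1 p.getVert (by omega) (adj_getVert_of_walkLength p ht)
      (fun i hi => (hfe _ _).1 (hcol i hi))
      (fun i hi heq => by
        have := hinj (show i ≤ p.length by omega) (show t + i ≤ p.length by omega) heq
        omega)
      (by
        rw [Finset.card_image_of_injOn, Finset.card_range, one_mul]
        intro i hi j hj heq
        simp only [Finset.coe_range, Set.mem_Iio] at hi hj
        exact hinj (show i ≤ p.length by omega) (show j ≤ p.length by omega) heq)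
    exact hg₁ s w hs1 hs2 hs3 hs4 fun i hi => (hg _ _ (hs5 i hi)).1
  have hno : ∀ (x y : SubdVertex V N) (p : (subdivision G g N).Walk x y),
      IsRepetitive (subdColouring g ψ τ) p → IsBoring p := by
    by_contra hcon
    push Not at hcon
    obtain ⟨x, y, p, ⟨t, ht, hcol⟩, hnb'⟩ := hcon
    obtain ⟨x', y', p', ⟨t', ht', hcol'⟩, hnb'', hlen⟩ := hh (SubdVertex V N) (subdivision G g N)
      c' f hpath (isDistanceTwoColouring_of_local f hfadj hfcommon)
      ⟨x, y, p, ⟨t, ht, fun i hi => (hfe _ _).2 (hcol i hi)⟩, hnb'⟩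
    have hpl := walkLength_eq p'
    rw [walkOrder_eq, ht'] at hlen
    have hadj := adj_getVert_of_walkLength p' ht'
    -- Since `f` is injective on neighbourhoods, a non-boring repetition has halves different at
    -- every position.
    obtain ⟨s, w, hs1, hs2, hs3, hs4, -, hs6⟩ := exists_repetition_of_subdivision ψ τ hN hgadj nb
      hnb hτ t' (h c') p'.getVert (by omega) hadj (fun i hi => (hfe _ _).1 (hcol' i hi))
      (fun i hi heq => hnb'' ⟨t', ht', halves_eq_of_eq f hfcommon t' p'.getVert hadj hcol' i hi heq⟩)
      hlen
    exact hψ s w hs1 hs2 hs3 hs4 hs6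
  let φ : V → Fin c × Fin N × Finset (Fin c × Fin N) := fun v =>
    (g v, ψ v, (Finset.univ.filter fun w => G.Adj v w).image fun w => (g w, ψ w))
  refine ⟨fun v => Fintype.equivFin _ (φ v), ?_⟩
  rintro x y p ⟨t, ht, hcol⟩
  have hpl := walkLength_eq p
  have hadj := adj_getVert_of_walkLength p ht
  have hφ : ∀ i < t, φ (p.getVert i) = φ (p.getVert (t + i)) := fun i hi =>
    (Fintype.equivFin _).injective (hcol i hi)
  have hφ' : ∀ i < t, g (p.getVert i) = g (p.getVert (t + i)) ∧
      ψ (p.getVert i) = ψ (p.getVert (t + i)) := by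
    intro i hi
    have := hφ i hi
    simp only [φ, Prod.mk.injEq] at this
    exact ⟨this.1, this.2.1⟩
  -- The third component of `φ` transfers the step from position `t - 1` to `t` into a step from the
  -- last vertex to some `z`, which completes the second half.
  obtain ⟨z, hz, hgz, hψz⟩ : ∃ z, G.Adj (p.getVert (2 * t - 1)) z ∧
      g z = g (p.getVert t) ∧ ψ z = ψ (p.getVert t) := by
    have h1 := hφ (t - 1) (by omega)
    simp only [φ, Prod.mk.injEq] at h1
    have h2 : (g (p.getVert t), ψ (p.getVert t)) ∈
        (Finset.univ.filter fun w => G.Adj (p.getVert (t - 1)) w).image fun w => (g w, ψ w) := by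
      refine Finset.mem_image_of_mem (fun w => (g w, ψ w)) ?_
      have := hadj (t - 1) (by omega)
      rw [show t - 1 + 1 = t by omega] at this
      simpa using this
    rw [h1.2.2, show t + (t - 1) = 2 * t - 1 by omega] at h2
    simpa using h2
  by_contra hnb'
  let w : ℕ → V := fun i => if i < 2 * t then p.getVert i else z
  have hw : ∀ i < 2 * t, w i = p.getVert i := fun i hi => if_pos hi
  have hwz : w (t + t) = z := if_neg (by omega)
  obtain ⟨x', y', p', hp', hnb''⟩ := exists_lift ψ τ hgadj t w (by omega) (by
      intro i hi
      rcases Nat.lt_or_ge (i + 1) (2 * t) with h | h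
      · rw [hw i hi, hw _ h]; exact hadj i h
      · rw [hw i hi, show i + 1 = t + t by omega, hwz, show i = 2 * t - 1 by omega]
        exact hz)
    (by
      intro i hi
      rcases Nat.lt_or_ge i t with h | h
      · rw [hw i (by omega), hw _ (by omega)]; exact (hφ' i h).1
      · obtain rfl : i = t := by omega
        rw [hwz, hw i (by omega), hgz])
    (by
      intro i hi
      rcases Nat.lt_or_ge i t with h | h
      · rw [hw i (by omega), hw _ (by omega)]; exact (hφ' i h).2
      · obtain rfl : i = t := by omega
        rw [hwz, hw i (by omega), hψz])
    (by
      by_contra hc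
      push Not at hc
      refine hnb' ⟨t, ht, fun i hi => ?_⟩
      have := hc i hi
      rwa [hw i (by omega), hw _ (by omega)] at this)
  exact hnb'' (hno _ _ p' hp')

/-! ### Maximum degree and the main theorem -/

/-- The neighbours of each vertex in a graph of maximum degree at most `Δ` can be listed. -/
theorem exists_neighbour_list {V : Type*} [Fintype V] (G : SimpleGraph V) [hdec : DecidableRel G.Adj]
    (Δ : ℕ) (hG : G.maxDegree ≤ Δ) :
    ∃ nb : V → Fin (Δ + 1) → V, ∀ v w, G.Adj v w → ∃ i, nb v i = w := by
  -- Unused indices return `v`; the spare index keeps the list non-empty when `Δ = 0`.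
  refine ⟨fun v i => if hi : (i : ℕ) < (G.neighborFinset v).card then
    (G.neighborFinset v).equivFin.symm ⟨i, hi⟩ else v, fun v w hvw => ?_⟩
  have hmem : w ∈ G.neighborFinset v := by simpa using hvw
  let j := (G.neighborFinset v).equivFin ⟨w, hmem⟩
  have hj := j.2
  have hdeg : (G.neighborFinset v).card ≤ Δ := (G.degree_le_maxDegree v).trans hG
  refine ⟨⟨j, by omega⟩, ?_⟩
  simp only [hj, dif_pos]
  exact congrArg Subtype.val ((G.neighborFinset v).equivFin.symm_apply_apply ⟨w, hmem⟩)

/-- A colouring of an isomorphic copy of `G` can be pulled back. -/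
theorem IsWalkNonrepetitive.comp_equiv {V W C : Type*} {G : SimpleGraph V} (e : V ≃ W)
    {φ : W → C} (h : IsWalkNonrepetitive (G.comap e.symm) φ) :
    IsWalkNonrepetitive G fun v => φ (e v) := by
  rintro u v p ⟨t, ht, hcol⟩
  let F : G →g G.comap e.symm := ⟨e, fun {a b} hab => by simpa using hab⟩
  have hlen : walkLength (p.map F) = walkLength p := by simp [walkLength]
  obtain ⟨t', ht', hb⟩ := h _ _ (p.map F) ⟨t, hlen.trans ht, fun i hi => by
    rw [SimpleGraph.Walk.getVert_map, SimpleGraph.Walk.getVert_map]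
    exact hcol i hi⟩
  refine ⟨t', hlen.symm.trans ht', fun i hi => e.injective ?_⟩
  have := hb i hi
  rw [SimpleGraph.Walk.getVert_map, SimpleGraph.Walk.getVert_map] at this
  exact this

end WalkColouring

theorem mainTheorem4 (hconj : WalkColouring.SmallWalksConjecture) :
    ∃ f : ℕ → ℕ,
      (∀ Δ : ℕ, WalkColouring.sigmaDegree Δ ≤ (f Δ : ℕ∞)) ∧
      ∀ (V : Type*) [Fintype V] (G : SimpleGraph V) [DecidableRel G.Adj],
        ∃ φ : V → Fin (f G.maxDegree), WalkColouring.IsWalkNonrepetitive G φ := by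
  choose f hf using fun Δ : ℕ =>
    WalkColouring.exists_colouring_of_smallWalks hconj (Δ + 1) (Nat.succ_pos Δ)
  refine ⟨f, fun Δ => ?_, ?_⟩
  · refine iSup_le fun n => iSup_le fun G => iSup_le fun hG => ?_
    obtain ⟨nb, hnb⟩ := WalkColouring.exists_neighbour_list G (hdec := _) Δ hG
    obtain ⟨φ, hφ⟩ := hf Δ (Fin n) G nb hnb
    have hle : WalkColouring.sigma G ≤ f Δ := Nat.sInf_le ⟨φ, hφ⟩
    exact_mod_cast hle
  · intro V _ G _
    obtain ⟨nb, hnb⟩ := WalkColouring.exists_neighbour_list G G.maxDegree le_rfl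
    -- The conjecture concerns vertex sets in `Type`, so an arbitrary universe is reached through a
    -- copy on `Fin`.
    let e := Fintype.equivFin V
    obtain ⟨φ, hφ⟩ := hf G.maxDegree (Fin (Fintype.card V)) (G.comap e.symm)
      (fun x i => e (nb (e.symm x) i)) (fun x y hxy => by
        obtain ⟨i, hi⟩ := hnb _ _ hxy
        exact ⟨i, by simp [hi]⟩)
    exact ⟨_, hφ.comp_equiv e⟩
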